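/- Let $W \in C^2(\mathbb R;\mathbb R)$ be such that $W, W', W''$ are bounded on $\mathbb R$, and suppose that $W'(x_0) \neq 0$ for some $x_0 \in \mathbb R$. For $b > 0$ and $k \in \mathbb R$ let $$h(k) = h(k;b,W) := -\frac{d^2}{dx^2} + (bx-k)^2 + W(x)$$ be the self-adjoint operator in $L^2(\mathbb R)$ defined initially on $C_0^\infty(\mathbb R)$ and then closed. Let $E_1(k) < E_2(k) < \cdots$, $E_j(k) = E_j(k;b,W)$, be the increasing sequence of all eigenvalues of $h(k)$. Then for each $j \in \mathbb N = \{1,2,\dots\}$ there exists $b_0 = b_0(j,W) > 0$ such that for every $b > b_0$ the following holds: for every $k \in \mathbb R$ the eigenvalues of $h(k)$ do form such an infinite strictly increasing sequence, the function $k \mapsto E_j(k;b,W)$ is bounded on $\mathbb R$, and $$\inf_{k \in \mathbb R} E_j(k;b,W) < \sup_{k \in \mathbb R} E_j(k;b,W).$$ That is, the $j$-th band $[\inf_k E_j(k), \sup_k E_j(k)]$ has positive length. -/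

import Mathlib

open MeasureTheory
open scoped ContDiff

namespace MagneticBand

/-- The complex Hilbert space `L²(ℝ)`. -/
abbrev L2 : Type := Lp ℂ 2 (volume : Measure ℝ)

/-- The differential expression `-φ'' + (b x - k)² φ + W φ`. -/
noncomputable def hExpr (b : ℝ) (W : ℝ → ℝ) (k : ℝ) (φ : ℝ → ℂ) (x : ℝ) : ℂ :=
  -deriv (deriv φ) x + (((b * x - k) ^ 2 + W x : ℝ) : ℂ) * φ x

theorem hExpr_add (b : ℝ) (W : ℝ → ℝ) (k : ℝ) {φ ψ : ℝ → ℂ}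
    (hφ : ContDiff ℝ ∞ φ) (hψ : ContDiff ℝ ∞ ψ) (x : ℝ) :
    hExpr b W k (φ + ψ) x = hExpr b W k φ x + hExpr b W k ψ x := by
  have h1 : deriv (φ + ψ) = deriv φ + deriv ψ := by
    funext y
    exact deriv_add (hφ.differentiable (by simp) y) (hψ.differentiable (by simp) y)
  have d1 : ContDiff ℝ ∞ (deriv φ) := (contDiff_infty_iff_deriv.1 hφ).2
  have d2 : ContDiff ℝ ∞ (deriv ψ) := (contDiff_infty_iff_deriv.1 hψ).2
  have h2 : deriv (deriv φ + deriv ψ) x = deriv (deriv φ) x + deriv (deriv ψ) x :=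
    deriv_add (d1.differentiable (by simp) x) (d2.differentiable (by simp) x)
  simp only [hExpr, h1, h2, Pi.add_apply]
  ring

theorem hExpr_smul (b : ℝ) (W : ℝ → ℝ) (k : ℝ) (c : ℂ) (φ : ℝ → ℂ) (x : ℝ) :
    hExpr b W k (c • φ) x = c * hExpr b W k φ x := by
  have h1 : deriv (c • φ) = c • deriv φ := by
    funext y
    exact deriv_const_smul_field c φ
  have h2 : deriv (c • deriv φ) x = c * deriv (deriv φ) x :=
    deriv_const_smul_field c (deriv φ)
  simp only [hExpr, h1, h2, Pi.smul_apply, smul_eq_mul]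
  ring

/-- The graph, in `L²(ℝ) × L²(ℝ)`, of `-d²/dx² + (b x - k)² + W(x)` acting on `C_0^∞(ℝ)`. -/
noncomputable def testGraph (b : ℝ) (W : ℝ → ℝ) (k : ℝ) : Submodule ℂ (L2 × L2) where
  carrier := {p | ∃ φ : ℝ → ℂ, ContDiff ℝ ∞ φ ∧ HasCompactSupport φ ∧
    p.1 =ᵐ[volume] φ ∧ p.2 =ᵐ[volume] hExpr b W k φ}
  zero_mem' := by
    refine ⟨0, contDiff_const, HasCompactSupport.zero, Lp.coeFn_zero ℂ 2 volume, ?_⟩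
    refine (Lp.coeFn_zero ℂ 2 volume).trans (Filter.Eventually.of_forall fun x => ?_)
    have : deriv (0 : ℝ → ℂ) = 0 := by
      funext y
      simp
    simp [hExpr, this]
  add_mem' := by
    rintro p q ⟨φ, h1, h2, h3, h4⟩ ⟨ψ, g1, g2, g3, g4⟩
    refine ⟨φ + ψ, h1.add g1, h2.add g2, ?_, ?_⟩
    · exact (Lp.coeFn_add p.1 q.1).trans (h3.add g3)
    · refine (Lp.coeFn_add p.2 q.2).trans ((h4.add g4).trans ?_)
      exact Filter.Eventually.of_forall fun x => (hExpr_add b W k h1 g1 x).symm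
  smul_mem' := by
    rintro c p ⟨φ, h1, h2, h3, h4⟩
    refine ⟨c • φ, h1.const_smul c, h2.smul_left (f := fun _ => c), ?_, ?_⟩
    · exact (Lp.coeFn_smul c p.1).trans (h3.const_smul c)
    · refine (Lp.coeFn_smul c p.2).trans ((h4.const_smul c).trans ?_)
      exact Filter.Eventually.of_forall fun x => (hExpr_smul b W k c φ x).symm

/-- `testGraph` is the graph of a function, so `Submodule.toLinearPMap` below is meaningful. -/
theorem testGraph_single_valued (b : ℝ) (W : ℝ → ℝ) (k : ℝ) :
    ∀ p ∈ testGraph b W k, p.1 = 0 → p.2 = 0 := by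
  rintro p ⟨φ, h1, -, h3, h4⟩ hp
  have hφ : φ =ᵐ[volume] (0 : ℝ → ℂ) := by
    rw [hp] at h3
    exact h3.symm.trans (Lp.coeFn_zero ℂ 2 volume)
  have h0 : φ = 0 := (h1.continuous.ae_eq_iff_eq volume continuous_const).1 hφ
  have hd : deriv (0 : ℝ → ℂ) = 0 := by
    funext y
    simp
  refine Lp.ext (h4.trans (Filter.EventuallyEq.trans ?_ (Lp.coeFn_zero ℂ 2 volume).symm))
  subst h0
  exact Filter.Eventually.of_forall fun x => by simp [hExpr, hd]

/-- The operator `-d²/dx² + (b x - k)² + W(x)` in `L²(ℝ)` with domain `C_0^∞(ℝ)`. -/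
noncomputable def hMin (b : ℝ) (W : ℝ → ℝ) (k : ℝ) : L2 →ₗ.[ℂ] L2 :=
  (testGraph b W k).toLinearPMap

theorem hMin_graph (b : ℝ) (W : ℝ → ℝ) (k : ℝ) :
    (hMin b W k).graph = testGraph b W k :=
  Submodule.toLinearPMap_graph_eq _ (testGraph_single_valued b W k)

/-- The operator `h(k) = -d²/dx² + (b x - k)² + W(x)` in `L²(ℝ)`: defined initially on
`C_0^∞(ℝ)` and then closed. For bounded measurable real `W` it is self-adjoint. -/
noncomputable def h (b : ℝ) (W : ℝ → ℝ) (k : ℝ) : L2 →ₗ.[ℂ] L2 :=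
  (hMin b W k).closure

/-- The set of (real) eigenvalues of `h(k)`. -/
def eigenvalues (b : ℝ) (W : ℝ → ℝ) (k : ℝ) : Set ℝ :=
  {e | ∃ u : (h b W k).domain, u ≠ 0 ∧ h b W k u = (e : ℂ) • (u : L2)}

/-- The band function `E_j(k) = E_j(k; b, W)`, `j = 1, 2, …`: the `j`-th smallest eigenvalue of
`h(k)`, i.e. the least eigenvalue `e` such that at least `j` eigenvalues are `≤ e`. -/
noncomputable def bandFunction (b : ℝ) (W : ℝ → ℝ) (j : ℕ) (k : ℝ) : ℝ :=
  sInf {e | e ∈ eigenvalues b W k ∧ (j : ℕ∞) ≤ {e' | e' ∈ eigenvalues b W k ∧ e' ≤ e}.encard}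

end MagneticBand

/-! Put `s = √b` and `a = k / b`. Then `h(k) - W` is the harmonic oscillator `-d²/dx² + s⁴(x - a)²`,
whose eigenfunctions are Hermite functions centred at `a`, with the Landau levels `(2n + 1) b` as
eigenvalues. Completeness of these functions turns the closed operator into "diagonal plus bounded":
`(u, g)` lies in its graph iff `⟨φ n, g - M u⟩ = lam n ⟨φ n, u⟩` for all `n`, where `M` is
multiplication by `W` (`mem_closure_testGraph_iff`).

If `|W| ≤ C` and `10 C ≤ b`, the gaps `2b ≥ 20 C` dwarf the perturbation, so exactly one eigenvalue
lies within `2C` of each level, and there are no others. A contraction argument gives existence;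
near-parallelism to `φ n` gives uniqueness (`exists_eigenvalue_seq`).

First order perturbation theory bounds `E_j(b y) - (2j - 1) b - W(y)` by twice the relative size of
`(M - W(y)) φ` for the corresponding Hermite function `φ`. As `W` is Lipschitz and `φ` lives at
distance `O(1/s)` from `y`, this is `O(b^(-1/2))` uniformly in `y` (`exists_localization`). Thus the
band reproduces the shape of `W`, which is not constant, and for large `b` it takes two different
values. -/

namespace MagneticBand

/-! ### Bounded symmetric perturbations of a diagonal operator with large gaps -/

section Perturbation

variable {H : Type*} [NormedAddCommGroup H] [InnerProductSpace ℂ H]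

/-- By Parseval the norm is monotone in the moduli of the coefficients, so operator bounds below can
be checked one coefficient at a time. -/
theorem norm_le_of_coeff_le (φ : HilbertBasis ℕ ℂ H) {x y : H}
    (hxy : ∀ n, ‖inner ℂ (φ n) x‖ ≤ ‖inner ℂ (φ n) y‖) : ‖x‖ ≤ ‖y‖ := by
  have key : ∀ z : H, HasSum (fun n => ‖inner ℂ (φ n) z‖ ^ 2) (‖z‖ ^ 2) := by
    intro z
    have h1 := φ.hasSum_inner_mul_inner z z
    rw [inner_self_eq_norm_sq_to_K] at h1
    have h2 := (RCLike.hasSum_re ℂ h1)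
    convert h2 using 1
    · funext n
      rw [← inner_conj_symm z (φ n), RCLike.conj_mul]
      norm_cast
    · norm_cast
  have := hasSum_le (fun n => pow_le_pow_left₀ (norm_nonneg _) (hxy n) 2) (key x) (key y)
  exact le_of_sq_le_sq this (norm_nonneg _)

theorem mul_norm_le_of_coeff_le (φ : HilbertBasis ℕ ℂ H) {x y : H} {c : ℝ} (hc : 0 ≤ c)
    (hxy : ∀ n, c * ‖inner ℂ (φ n) x‖ ≤ ‖inner ℂ (φ n) y‖) : c * ‖x‖ ≤ ‖y‖ := by
  have h1 : ‖(c : ℂ) • x‖ ≤ ‖y‖ := by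
    refine norm_le_of_coeff_le φ fun n => ?_
    rw [inner_smul_right, norm_mul, Complex.norm_real, Real.norm_of_nonneg hc]
    exact hxy n
  rwa [norm_smul, Complex.norm_real, Real.norm_of_nonneg hc] at h1

theorem eq_of_coeff_eq (φ : HilbertBasis ℕ ℂ H) {x y : H}
    (hxy : ∀ n, inner ℂ (φ n) x = inner ℂ (φ n) y) : x = y := by
  refine φ.repr.injective (lp.ext (funext fun n => ?_))
  rw [φ.repr_apply_apply, φ.repr_apply_apply, hxy]

/-- Bounded sequences act as diagonal operators in an orthonormal basis. -/
theorem exists_diagonal (φ : HilbertBasis ℕ ℂ H) (s : ℕ → ℂ) {c : ℝ} (hc : 0 ≤ c)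
    (hs : ∀ n, ‖s n‖ ≤ c) :
    ∃ S : H → H, (∀ x n, inner ℂ (φ n) (S x) = s n * inner ℂ (φ n) x) ∧
      (∀ x, ‖S x‖ ≤ c * ‖x‖) ∧ ∀ x y, S (x - y) = S x - S y := by
  have hmem : ∀ x : H, Memℓp (fun n => s n * inner ℂ (φ n) x) 2 := by
    intro x
    have h1 : Memℓp (fun n => (φ.repr ((c : ℂ) • x)) n) 2 := (φ.repr ((c : ℂ) • x)).2
    refine memℓp_gen ((h1.summable (by simp)).of_nonneg_of_le (fun n => by positivity)
      fun n => ?_)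
    refine Real.rpow_le_rpow (norm_nonneg _) ?_ (by simp)
    rw [φ.repr_apply_apply, inner_smul_right, norm_mul, norm_mul, Complex.norm_real,
      Real.norm_of_nonneg hc]
    gcongr
    exact hs n
  let S : H → H := fun x => φ.repr.symm ⟨_, hmem x⟩
  have hS : ∀ x n, inner ℂ (φ n) (S x) = s n * inner ℂ (φ n) x := by
    intro x n
    rw [← φ.repr_apply_apply]
    simp [S]
  refine ⟨S, hS, fun x => ?_, fun x y => eq_of_coeff_eq φ fun n => ?_⟩
  · have : ‖S x‖ ≤ ‖(c : ℂ) • x‖ := by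
      refine norm_le_of_coeff_le φ fun n => ?_
      rw [hS, inner_smul_right, norm_mul, norm_mul, Complex.norm_real, Real.norm_of_nonneg hc]
      gcongr
      exact hs n
    rwa [norm_smul, Complex.norm_real, Real.norm_of_nonneg hc] at this
  · rw [hS, inner_sub_right, inner_sub_right, hS, hS, mul_sub]

/-- `u` solves the eigenvalue equation `(D + M) u = e u`, in the weak sense, where `D` is the
diagonal operator with eigenvalues `lam n` in the basis `φ`. -/
def DiagEigen (φ : HilbertBasis ℕ ℂ H) (lam : ℕ → ℝ) (M : H →L[ℂ] H) (e : ℂ) (u : H) : Prop :=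
  ∀ n, (e - lam n) * inner ℂ (φ n) u = inner ℂ (φ n) (M u)

variable {φ : HilbertBasis ℕ ℂ H} {lam : ℕ → ℝ} {M : H →L[ℂ] H} {C : ℝ}

/-- Otherwise the equation, read coefficientwise, would give `2C‖u‖ ≤ ‖M u‖ ≤ C‖u‖`. -/
theorem DiagEigen.exists_near {e : ℝ} {u : H} (hC : 0 < C) (hM : ∀ x, ‖M x‖ ≤ C * ‖x‖)
    (hu : u ≠ 0) (he : DiagEigen φ lam M e u) : ∃ n, |e - lam n| ≤ 2 * C := by
  by_contra! hcon
  have h1 : (2 * C) * ‖u‖ ≤ ‖M u‖ := by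
    refine mul_norm_le_of_coeff_le φ (by positivity) fun n => ?_
    rw [← he n, norm_mul]
    gcongr
    rw [← Complex.ofReal_sub, Complex.norm_real]
    exact (hcon n).le
  have h2 : 0 < C * ‖u‖ := mul_pos hC (norm_pos_iff.2 hu)
  linarith [hM u]

/-- Expand `⟨M u, u'⟩ = ⟨u, M u'⟩` by Parseval. Taking `u = u'` shows that eigenvalues are real;
distinct real eigenvalues give orthogonal eigenvectors. Complex `e` is allowed because the fixed
point argument does not produce a real one a priori. -/
theorem DiagEigen.conj_sub_mul_inner {e e' : ℂ} {u u' : H}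
    (hsym : ∀ x y, inner ℂ (M x) y = inner ℂ x (M y))
    (he : DiagEigen φ lam M e u) (he' : DiagEigen φ lam M e' u') :
    ((starRingEnd ℂ) e - e') * inner ℂ u u' = 0 := by
  have h1 := φ.hasSum_inner_mul_inner (M u) u'
  have h2 := φ.hasSum_inner_mul_inner u (M u')
  have h3 := (φ.hasSum_inner_mul_inner u u').mul_left ((starRingEnd ℂ) e - e')
  have h4 := h1.sub h2
  rw [hsym, sub_self] at h4
  refine h3.unique ?_
  have h5 : ∀ n, ((starRingEnd ℂ) e - e') * (inner ℂ u (φ n) * inner ℂ (φ n) u') =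
      inner ℂ (M u) (φ n) * inner ℂ (φ n) u' - inner ℂ u (φ n) * inner ℂ (φ n) (M u') := by
    intro n
    rw [← he' n, ← inner_conj_symm (M u), ← he n, ← inner_conj_symm u]
    simp only [map_mul, map_sub, Complex.conj_ofReal]
    ring
  simp only [h5]
  exact h4

/-- An eigenvector for an eigenvalue close to `lam n` is almost parallel to `φ n`. -/
theorem DiagEigen.norm_sub_le {e : ℝ} {u : H} {n : ℕ} (hC : 0 < C)
    (hM : ∀ x, ‖M x‖ ≤ C * ‖x‖) (hgap : ∀ n m, n ≠ m → 20 * C ≤ |lam n - lam m|)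
    (he : DiagEigen φ lam M e u) (hn : |e - lam n| ≤ 2 * C) :
    18 * ‖u - inner ℂ (φ n) u • φ n‖ ≤ ‖u‖ := by
  have h1 : (18 * C) * ‖u - inner ℂ (φ n) u • φ n‖ ≤ ‖M u‖ := by
    refine mul_norm_le_of_coeff_le φ (by positivity) fun m => ?_
    rw [inner_sub_right, inner_smul_right, orthonormal_iff_ite.1 φ.orthonormal]
    split_ifs with hmn
    · subst hmn
      simp
    · rw [mul_zero, sub_zero, ← he m, norm_mul]
      gcongr
      rw [← Complex.ofReal_sub, Complex.norm_real, Real.norm_eq_abs]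
      -- Every other level is at distance at least `20C - 2C = 18C` from `e`.
      have h2 := hgap n m (Ne.symm hmn)
      have h3 := abs_sub_abs_le_abs_sub (lam n - lam m) (-(e - lam n))
      rw [abs_neg] at h3
      have h4 : lam n - lam m - -(e - lam n) = e - lam m := by ring
      rw [h4] at h3
      linarith
  have h2 := hM u
  have h3 : C * (18 * ‖u - inner ℂ (φ n) u • φ n‖) ≤ C * ‖u‖ := by linarith
  exact le_of_mul_le_mul_left h3 hC

theorem DiagEigen.norm_le_coeff {e : ℝ} {u : H} {n : ℕ} (hC : 0 < C)
    (hM : ∀ x, ‖M x‖ ≤ C * ‖x‖) (hgap : ∀ n m, n ≠ m → 20 * C ≤ |lam n - lam m|)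
    (he : DiagEigen φ lam M e u) (hn : |e - lam n| ≤ 2 * C) :
    17 * ‖u‖ ≤ 18 * ‖inner ℂ (φ n) u‖ := by
  have h1 := he.norm_sub_le hC hM hgap hn
  have h2 := norm_sub_norm_le u (inner ℂ (φ n) u • φ n)
  rw [norm_smul, φ.orthonormal.1 n, mul_one] at h2
  linarith

/-- If `e ≠ e'`, then `u ⊥ u'`, so the components orthogonal to `φ n` have inner product `-conj a *
a'`. Its modulus is at least `(17/18)²‖u‖‖u'‖`, while Cauchy–Schwarz allows only `(1/18)²‖u‖‖u'‖`.
-/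
theorem DiagEigen.unique {e e' : ℝ} {u u' : H} {n : ℕ} (hC : 0 < C)
    (hM : ∀ x, ‖M x‖ ≤ C * ‖x‖) (hsym : ∀ x y, inner ℂ (M x) y = inner ℂ x (M y))
    (hgap : ∀ n m, n ≠ m → 20 * C ≤ |lam n - lam m|) (hu : u ≠ 0) (hu' : u' ≠ 0)
    (he : DiagEigen φ lam M e u) (he' : DiagEigen φ lam M e' u')
    (hn : |e - lam n| ≤ 2 * C) (hn' : |e' - lam n| ≤ 2 * C) : e = e' := by
  have h0 := he.conj_sub_mul_inner hsym he'
  rw [Complex.conj_ofReal] at h0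
  rcases mul_eq_zero.1 h0 with h | h
  · exact_mod_cast sub_eq_zero.1 h
  exfalso
  have hp : 0 < ‖u‖ := norm_pos_iff.2 hu
  have hp' : 0 < ‖u'‖ := norm_pos_iff.2 hu'
  have a1 := he.norm_sub_le hC hM hgap hn
  have a2 := he'.norm_sub_le hC hM hgap hn'
  have b1 := he.norm_le_coeff hC hM hgap hn
  have b2 := he'.norm_le_coeff hC hM hgap hn'
  set a := inner ℂ (φ n) u with ha
  set a' := inner ℂ (φ n) u' with ha'
  have h1 : inner ℂ (u - a • φ n) (u' - a' • φ n) = -((starRingEnd ℂ) a * a') := by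
    rw [inner_sub_left, inner_sub_right, inner_sub_right, h, inner_smul_left, inner_smul_right,
      inner_smul_left, inner_smul_right, ← ha', ← inner_conj_symm, ← ha,
      inner_self_eq_norm_sq_to_K, φ.orthonormal.1 n]
    push_cast
    ring
  have h2 := norm_inner_le_norm (𝕜 := ℂ) (u - a • φ n) (u' - a' • φ n)
  rw [h1, norm_neg, norm_mul, RCLike.norm_conj] at h2
  have h3 : (17 * ‖u‖) * (17 * ‖u'‖) ≤ (18 * ‖a‖) * (18 * ‖a'‖) :=
    mul_le_mul b1 b2 (by positivity) (by positivity)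
  have h4 : (18 * ‖u - a • φ n‖) * (18 * ‖u' - a' • φ n‖) ≤ ‖u‖ * ‖u'‖ :=
    mul_le_mul a1 a2 (by positivity) (by positivity)
  have h5 : 0 < ‖u‖ * ‖u'‖ := mul_pos hp hp'
  nlinarith

/-- First order perturbation theory. -/
theorem DiagEigen.abs_sub_le {e w δ : ℝ} {u : H} {n : ℕ} (hC : 0 < C)
    (hM : ∀ x, ‖M x‖ ≤ C * ‖x‖) (hsym : ∀ x y, inner ℂ (M x) y = inner ℂ x (M y))
    (hgap : ∀ n m, n ≠ m → 20 * C ≤ |lam n - lam m|) (hu : u ≠ 0)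
    (he : DiagEigen φ lam M e u) (hn : |e - lam n| ≤ 2 * C)
    (hδ : ‖M (φ n) - (w : ℂ) • φ n‖ ≤ δ) : |e - lam n - w| ≤ 2 * δ := by
  have b1 := he.norm_le_coeff hC hM hgap hn
  have hp : 0 < ‖u‖ := norm_pos_iff.2 hu
  -- Pair the eigenvalue equation with `φ n` and move `M` across. Since the coefficient of `u` along
  -- `φ n` is at least `17/18 ‖u‖`, dividing by it costs less than a factor 2.
  have h1 : ((e - lam n - w : ℝ) : ℂ) * inner ℂ (φ n) u = inner ℂ (M (φ n) - (w : ℂ) • φ n) u := by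
    rw [inner_sub_left, hsym, ← he n, inner_smul_left, Complex.conj_ofReal]
    push_cast
    ring
  have h2 := norm_inner_le_norm (𝕜 := ℂ) (M (φ n) - (w : ℂ) • φ n) u
  rw [← h1, norm_mul, Complex.norm_real, Real.norm_eq_abs] at h2
  have h3 : ‖M (φ n) - (w : ℂ) • φ n‖ * ‖u‖ ≤ δ * ‖u‖ := by gcongr
  have h4 : |e - lam n - w| * (17 * ‖u‖) ≤ |e - lam n - w| * (18 * ‖inner ℂ (φ n) u‖) := by gcongr
  have hδ0 : 0 ≤ δ := (norm_nonneg _).trans hδ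
  have h5 : |e - lam n - w| * ‖u‖ ≤ 2 * δ * ‖u‖ := by nlinarith [mul_nonneg hδ0 hp.le]
  exact le_of_mul_le_mul_right h5 hp

/-- Lyapunov–Schmidt reduction: for `u = φ n + v` with `v ⊥ φ n`, the `n`-th equation forces the
eigenvalue `lam n + μ v`, and the others say `v = S (M u - μ v • u)`, with `S` the reduced resolvent
at `lam n`. As `‖S‖ ≤ 1/(20C)`, the right side maps the unit ball into itself (`6C ≤ 20C`) and
contracts it (`5C ≤ 10C`). -/
theorem exists_fixed_perturbation [CompleteSpace H] (n : ℕ) (hC : 0 < C) (hM : ∀ x, ‖M x‖ ≤ C * ‖x‖)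
    (hgap : ∀ n m, n ≠ m → 20 * C ≤ |lam n - lam m|) :
    ∃ v : H, ‖v‖ ≤ 1 ∧ inner ℂ (φ n) v = 0 ∧
      DiagEigen φ lam M (lam n + inner ℂ (φ n) (M (φ n + v))) (φ n + v) := by
  obtain ⟨S, hS1, hS2, hS3⟩ := exists_diagonal φ
    -- The zero at `m = n` keeps the fixed point orthogonal to `φ n`.
    (fun m => if m = n then 0 else ((lam n - lam m : ℝ) : ℂ)⁻¹) (c := (20 * C)⁻¹) (by positivity)
    (by
      intro m
      split_ifs with hm
      · simp only [norm_zero]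
        positivity
      · rw [norm_inv, Complex.norm_real, Real.norm_eq_abs]
        exact inv_anti₀ (by positivity) (hgap n m (Ne.symm hm)))
  have hφ : ‖φ n‖ = 1 := φ.orthonormal.1 n
  let μ : H → ℂ := fun v => inner ℂ (φ n) (M (φ n + v))
  let F : H → H := fun v => S (M (φ n + v) - μ v • (φ n + v))
  have hadd : ∀ v : H, ‖v‖ ≤ 1 → ‖φ n + v‖ ≤ 2 := fun v hv => by
    linarith [norm_add_le (φ n) v]
  have hMφ : ∀ v : H, ‖v‖ ≤ 1 → ‖M (φ n + v)‖ ≤ 2 * C := fun v hv => by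
    nlinarith [hM (φ n + v), hadd v hv]
  have hinner : ∀ x : H, ‖inner ℂ (φ n) x‖ ≤ ‖x‖ := fun x => by
    simpa [hφ] using norm_inner_le_norm (𝕜 := ℂ) (φ n) x
  have hμ : ∀ v : H, ‖v‖ ≤ 1 → ‖μ v‖ ≤ 2 * C := fun v hv => (hinner _).trans (hMφ v hv)
  have hmaps : Set.MapsTo F (Metric.closedBall 0 1) (Metric.closedBall 0 1) := by
    intro v hv
    rw [mem_closedBall_zero_iff] at hv ⊢
    refine (hS2 _).trans ?_
    have h1 : ‖M (φ n + v) - μ v • (φ n + v)‖ ≤ 2 * C + 2 * C * 2 := by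
      refine (norm_sub_le _ _).trans (add_le_add (hMφ v hv) ?_)
      rw [norm_smul]
      exact mul_le_mul (hμ v hv) (hadd v hv) (norm_nonneg _) (by positivity)
    rw [inv_mul_le_iff₀ (by positivity)]
    linarith
  have hcontr : ContractingWith (1 / 2) (Set.MapsTo.restrict F _ _ hmaps) := by
    refine ⟨by norm_num, LipschitzWith.of_dist_le_mul fun v w => ?_⟩
    obtain ⟨v, hv⟩ := v
    obtain ⟨w, hw⟩ := w
    rw [mem_closedBall_zero_iff] at hv hw
    rw [Subtype.dist_eq, Subtype.dist_eq, dist_eq_norm, dist_eq_norm]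
    simp only [Set.MapsTo.val_restrict_apply]
    change ‖S _ - S _‖ ≤ _
    rw [← hS3]
    refine (hS2 _).trans ?_
    have h0 : M (φ n + v) - μ v • (φ n + v) - (M (φ n + w) - μ w • (φ n + w)) =
        M (v - w) - (inner ℂ (φ n) (M (v - w)) • (φ n + v) + μ w • (v - w)) := by
      have : inner ℂ (φ n) (M (v - w)) = μ v - μ w := by
        simp only [μ]
        rw [← inner_sub_right, ← map_sub]
        congr 2
        abel
      rw [this]
      simp only [map_add, map_sub]
      module
    rw [h0]
    have h1 := norm_sub_le (M (v - w)) (inner ℂ (φ n) (M (v - w)) • (φ n + v) + μ w • (v - w))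
    have h2 := norm_add_le (inner ℂ (φ n) (M (v - w)) • (φ n + v)) (μ w • (v - w))
    rw [norm_smul, norm_smul] at h2
    have h3 : ‖inner ℂ (φ n) (M (v - w))‖ * ‖φ n + v‖ ≤ C * ‖v - w‖ * 2 :=
      mul_le_mul ((hinner _).trans (hM _)) (hadd v hv) (norm_nonneg _) (by positivity)
    have h4 : ‖μ w‖ * ‖v - w‖ ≤ 2 * C * ‖v - w‖ := by gcongr; exact hμ w hw
    rw [inv_mul_le_iff₀ (by positivity)]
    have h5 := hM (v - w)
    have h6 : 0 ≤ C * ‖v - w‖ := by positivity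
    push_cast
    linarith
  obtain ⟨v, hv, hfix, -⟩ := ContractingWith.exists_fixedPoint'
    (Metric.isClosed_closedBall.isComplete) hmaps hcontr
    (Metric.mem_closedBall_self (x := (0 : H)) zero_le_one) (edist_ne_top _ _)
  rw [mem_closedBall_zero_iff] at hv
  have hfix' : S (M (φ n + v) - μ v • (φ n + v)) = v := hfix
  have hcoef : ∀ m, inner ℂ (φ m) v = (if m = n then 0 else ((lam n - lam m : ℝ) : ℂ)⁻¹) *
      inner ℂ (φ m) (M (φ n + v) - μ v • (φ n + v)) := fun m => by
    rw [← hS1, hfix']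
  have hn0 : inner ℂ (φ n) v = 0 := by rw [hcoef]; simp
  refine ⟨v, hv, hn0, fun m => ?_⟩
  change ((lam n : ℂ) + μ v - lam m) * _ = _
  by_cases hmn : m = n
  · subst hmn
    rw [inner_add_right, hn0, inner_self_eq_norm_sq_to_K, hφ]
    simp [μ]
  · have h1 := hcoef m
    rw [if_neg hmn] at h1
    have h2 : ((lam n - lam m : ℝ) : ℂ) ≠ 0 := by
      rw [Complex.ofReal_ne_zero, ← abs_pos]
      exact lt_of_lt_of_le (by positivity) (hgap n m (Ne.symm hmn))
    rw [eq_inv_mul_iff_mul_eq₀ h2, inner_sub_right, inner_smul_right] at h1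
    have h3 : inner ℂ (φ m) (φ n + v) = inner ℂ (φ m) v := by
      rw [inner_add_right, orthonormal_iff_ite.1 φ.orthonormal, if_neg hmn, zero_add]
    rw [h3] at h1 ⊢
    push_cast at h1
    linear_combination h1

theorem exists_diagEigen [CompleteSpace H] (n : ℕ) (hC : 0 < C) (hM : ∀ x, ‖M x‖ ≤ C * ‖x‖)
    (hsym : ∀ x y, inner ℂ (M x) y = inner ℂ x (M y))
    (hgap : ∀ n m, n ≠ m → 20 * C ≤ |lam n - lam m|) :
    ∃ e : ℝ, ∃ u : H, u ≠ 0 ∧ DiagEigen φ lam M e u ∧ |e - lam n| ≤ 2 * C := by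
  obtain ⟨v, hv1, hv2, hv⟩ := exists_fixed_perturbation (φ := φ) n hC hM hgap
  have hφ : ‖φ n‖ = 1 := φ.orthonormal.1 n
  have hu : φ n + v ≠ 0 := by
    intro h0
    have : inner ℂ (φ n) (φ n + v) = 1 := by
      rw [inner_add_right, hv2, inner_self_eq_norm_sq_to_K, hφ]
      simp
    rw [h0, inner_zero_right] at this
    exact zero_ne_one this
  have hreal := hv.conj_sub_mul_inner hsym hv
  rw [mul_eq_zero, or_iff_left (inner_self_ne_zero.2 hu), sub_eq_zero] at hreal
  obtain ⟨e, he⟩ := Complex.conj_eq_iff_real.1 hreal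
  rw [he] at hv
  refine ⟨e, _, hu, hv, ?_⟩
  have h1 : ((e - lam n : ℝ) : ℂ) = inner ℂ (φ n) (M (φ n + v)) := by
    push_cast
    rw [← he]
    ring
  rw [← Real.norm_eq_abs, ← Complex.norm_real, h1]
  have h2 := norm_inner_le_norm (𝕜 := ℂ) (φ n) (M (φ n + v))
  rw [hφ, one_mul] at h2
  nlinarith [hM (φ n + v), norm_add_le (φ n) v]

end Perturbation

/-! ### Counting eigenvalues -/

/-- If the eigenvalues form a strictly increasing sequence `e`, then the band functions list it. -/
theorem bandFunction_eq {b : ℝ} {W : ℝ → ℝ} {k : ℝ} {e : ℕ → ℝ} (he : StrictMono e)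
    (hS : eigenvalues b W k = Set.range e) (i : ℕ) (hi : 1 ≤ i) :
    bandFunction b W i k = e (i - 1) := by
  -- Bands are numbered from 1 and `e` from 0: `n + 1` eigenvalues are at most `e n`.
  have hcard : ∀ n, {e' | e' ∈ eigenvalues b W k ∧ e' ≤ e n}.encard = ((n + 1 : ℕ) : ℕ∞) := by
    intro n
    have : {e' | e' ∈ eigenvalues b W k ∧ e' ≤ e n} = e '' (Finset.range (n + 1) : Finset ℕ) := by
      ext x
      simp only [hS, Set.mem_ofPred_eq, Set.mem_range, Finset.coe_range, Set.mem_image, Set.mem_Iio]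
      constructor
      · rintro ⟨⟨m, rfl⟩, hm⟩
        exact ⟨m, Nat.lt_succ_of_le (he.le_iff_le.1 hm), rfl⟩
      · rintro ⟨m, hm, rfl⟩
        exact ⟨⟨m, rfl⟩, he.monotone (Nat.le_of_lt_succ hm)⟩
    rw [this, he.injective.encard_image, Set.encard_coe_eq_coe_finsetCard, Finset.card_range]
  refine IsLeast.csInf_eq ⟨⟨hS ▸ ⟨_, rfl⟩, ?_⟩, ?_⟩
  · rw [hcard, Nat.sub_add_cancel hi]
  · rintro x ⟨hx, hx2⟩
    rw [hS] at hx
    obtain ⟨n, rfl⟩ := hx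
    rw [hcard, Nat.cast_le] at hx2
    exact he.monotone (by omega)

open Polynomial (C X derivative)

/-! ### Injectivity of the Fourier transform -/

section Fourier

open scoped FourierTransform SchwartzMap

/-- The Fourier transform is injective on integrable functions. -/
theorem ae_eq_zero_of_fourier_eq_zero {g : ℝ → ℂ} (hg : Integrable g) (h0 : 𝓕 g = 0) :
    ∀ᵐ x, g x = 0 := by
  refine ae_eq_zero_of_integral_contDiff_smul_eq_zero hg.locallyIntegrable fun χ hχ hc => ?_
  have hχ' : ContDiff ℝ ∞ (fun x => (χ x : ℂ)) := Complex.ofRealCLM.contDiff.comp hχ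
  have hc' : HasCompactSupport (fun x => (χ x : ℂ)) := hc.comp_left (g := Complex.ofReal) (by simp)
  let S : 𝓢(ℝ, ℂ) := hc'.toSchwartzMap hχ'
  -- Write the test function as `𝓕 T` and move the transform onto `g`.
  let T : 𝓢(ℝ, ℂ) := 𝓕⁻ S
  have hT : 𝓕 (T : ℝ → ℂ) = S := by
    rw [← SchwartzMap.fourier_coe, FourierTransform.fourier_fourierInv_eq]
  have h1 := VectorFourier.integral_fourierIntegral_smul_eq_flip (L := innerₗ ℝ)
    Real.continuous_fourierChar continuous_inner hg (T.integrable (μ := volume))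
  have h2 : ∀ x, VectorFourier.fourierIntegral Real.fourierChar volume (innerₗ ℝ).flip T x
      = S x := by
    intro x
    rw [← hT]
    simp only [flip_innerₗ]
    rfl
  have h3 : ∀ x, VectorFourier.fourierIntegral Real.fourierChar volume (innerₗ ℝ) g x = 0 :=
    fun x => congrFun h0 x
  simp only [h2, h3, zero_smul, integral_zero] at h1
  rw [h1]
  refine integral_congr_ae (Filter.Eventually.of_forall fun x => ?_)
  simp [S, mul_comm]

end Fourier

/-! ### Hermite functions: eigenvalue equation and completeness -/

theorem integrable_poly_mul_gaussian (p : Polynomial ℝ) {c : ℝ} (hc : 0 < c) :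
    Integrable (fun x : ℝ => p.eval x * Real.exp (-c * x ^ 2)) := by
  induction p using Polynomial.induction_on' with
  | add p q hp hq =>
    simp only [Polynomial.eval_add, add_mul]
    exact hp.add hq
  | monomial n a =>
    have h1 := (integrable_rpow_mul_exp_neg_mul_sq hc (s := n)
      (by linarith [Nat.cast_nonneg (α := ℝ) n])).const_mul a
    simpa [Polynomial.eval_monomial, mul_assoc] using h1

/-- The function `p(y) exp(-c y²)` of the variable `y = s (x - a)`. -/
noncomputable def polyGauss (s a c : ℝ) (p : Polynomial ℝ) (x : ℝ) : ℝ :=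
  p.eval (s * (x - a)) * Real.exp (-c * (s * (x - a)) ^ 2)

variable {s a c : ℝ}

theorem contDiff_polyGauss (p : Polynomial ℝ) {n : WithTop ℕ∞} :
    ContDiff ℝ n (polyGauss s a c p) := by
  have h1 : ContDiff ℝ n (fun x : ℝ => s * (x - a)) := by fun_prop
  have h2 : ContDiff ℝ n (fun y : ℝ => p.eval y) := by
    simpa using Polynomial.contDiff_aeval p (𝕜 := ℝ) n
  exact (h2.comp h1).mul (by fun_prop)

theorem integrable_polyGauss (hs : s ≠ 0) (hc : 0 < c) (p : Polynomial ℝ) :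
    Integrable (polyGauss s a c p) :=
  ((integrable_poly_mul_gaussian p hc).comp_mul_left' hs).comp_sub_right a

theorem memLp_polyGauss (hs : s ≠ 0) (hc : 0 < c) (p : Polynomial ℝ) :
    MemLp (polyGauss s a c p) 2 := by
  rw [memLp_two_iff_integrable_sq (contDiff_polyGauss (n := 0) p).continuous.aestronglyMeasurable]
  have h1 : (fun x => polyGauss s a c p x ^ 2) = polyGauss s a (2 * c) (p ^ 2) := by
    funext x
    simp only [polyGauss]
    rw [mul_pow, Polynomial.eval_pow, ← Real.exp_nat_mul]
    push_cast
    ring_nf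
  rw [h1]
  exact integrable_polyGauss hs (mul_pos two_pos hc) _

theorem memLp_ofReal_polyGauss (hs : s ≠ 0) (hc : 0 < c) (p : Polynomial ℝ) :
    MemLp (fun x => (polyGauss s a c p x : ℂ)) 2 :=
  (memLp_polyGauss hs hc p).ofReal

theorem hasDerivAt_polyGauss (p : Polynomial ℝ) (x : ℝ) :
    HasDerivAt (polyGauss s a 2⁻¹ p) (s * polyGauss s a 2⁻¹ (derivative p - X * p) x) x := by
  have h1 : HasDerivAt (fun x : ℝ => s * (x - a)) s x := by
    simpa using ((hasDerivAt_id x).sub_const a).const_mul s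
  have h2 : HasDerivAt (fun x => p.eval (s * (x - a)))
      ((derivative p).eval (s * (x - a)) * s) x :=
    (p.hasDerivAt (s * (x - a))).comp (h := fun x : ℝ => s * (x - a)) x h1
  have h3 := ((h1.pow 2).const_mul (-(2⁻¹ : ℝ))).exp
  refine (h2.mul h3).congr_deriv ?_
  simp only [polyGauss, Polynomial.eval_sub, Polynomial.eval_mul, Polynomial.eval_X, Pi.pow_apply]
  ring

/-- The (physicists') Hermite polynomials. -/
noncomputable def hermitePoly : ℕ → Polynomial ℝ
  | 0 => 1
  | n + 1 => 2 * X * hermitePoly n - derivative (hermitePoly n)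

/-- Induction: the equation for `n` yields the lowering relation `H' = (2n + 2) Hₙ` for `H = Hₙ₊₁`,
and differentiating that gives the next equation. -/
theorem hermitePoly_ode (n : ℕ) :
    derivative (derivative (hermitePoly n)) =
      2 * X * derivative (hermitePoly n) - 2 * (n : Polynomial ℝ) * hermitePoly n := by
  induction n with
  | zero => simp [hermitePoly]
  | succ n ih =>
    have h1 : derivative (hermitePoly (n + 1)) = (2 * n + 2) * hermitePoly n := by
      rw [hermitePoly]
      simp only [Polynomial.derivative_sub, Polynomial.derivative_mul, ih, Polynomial.derivative_X,
        Polynomial.derivative_ofNat]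
      ring
    rw [h1]
    have h2 : derivative ((2 * (n : Polynomial ℝ) + 2) * hermitePoly n) =
        (2 * (n : Polynomial ℝ) + 2) * derivative (hermitePoly n) := by
      simp [Polynomial.derivative_mul]
    rw [h2, hermitePoly]
    push_cast
    ring

theorem derivative_hermitePoly_succ (n : ℕ) :
    derivative (hermitePoly (n + 1)) = (2 * n + 2) * hermitePoly n := by
  rw [hermitePoly]
  simp only [Polynomial.derivative_sub, Polynomial.derivative_mul, hermitePoly_ode,
    Polynomial.derivative_X, Polynomial.derivative_ofNat]
  ring

theorem hermitePoly_ne_zero (n : ℕ) : hermitePoly n ≠ 0 := by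
  induction n with
  | zero => exact one_ne_zero
  | succ n ih =>
    intro h0
    have h1 := derivative_hermitePoly_succ n
    rw [h0, Polynomial.derivative_zero] at h1
    have h2 : (2 * (n : Polynomial ℝ) + 2) ≠ 0 := by
      have : (2 * (n : Polynomial ℝ) + 2) = ((2 * n + 2 : ℕ) : Polynomial ℝ) := by push_cast; ring
      rw [this]
      exact Nat.cast_ne_zero.2 (by omega)
    exact (mul_ne_zero h2 ih) h1.symm

/-- The span contains 1 and is stable under multiplication by `X`, because `X Hₙ = (Hₙ₊₁ + Hₙ') / 2`
and `Hₙ'` is zero or a multiple of the preceding polynomial. -/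
theorem span_hermitePoly : Submodule.span ℝ (Set.range hermitePoly) = ⊤ := by
  set V := Submodule.span ℝ (Set.range hermitePoly) with hV
  have hmem : ∀ n, hermitePoly n ∈ V := fun n => Submodule.subset_span ⟨n, rfl⟩
  have hder : ∀ n, derivative (hermitePoly n) ∈ V := by
    intro n
    cases n with
    | zero => simp [hermitePoly]
    | succ n =>
      rw [derivative_hermitePoly_succ]
      have : (2 * (n : Polynomial ℝ) + 2) * hermitePoly n = (2 * n + 2 : ℝ) • hermitePoly n := by
        rw [Polynomial.smul_eq_C_mul]
        simp only [map_add, map_mul, map_natCast, map_ofNat]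
      rw [this]
      exact V.smul_mem _ (hmem n)
  have hX : ∀ p ∈ V, X * p ∈ V := by
    intro p hp
    induction hp using Submodule.span_induction with
    | mem p hp =>
      obtain ⟨n, rfl⟩ := hp
      have : X * hermitePoly n =
          (2⁻¹ : ℝ) • (hermitePoly (n + 1) + derivative (hermitePoly n)) := by
        rw [hermitePoly, Polynomial.smul_eq_C_mul, sub_add_cancel, mul_assoc, ← mul_assoc]
        have : (C 2⁻¹ * 2 : Polynomial ℝ) = 1 := by
          rw [← Polynomial.C_ofNat, ← Polynomial.C_mul]
          norm_num
        rw [this, one_mul]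
      rw [this]
      exact V.smul_mem _ (V.add_mem (hmem _) (hder n))
    | zero => simp
    | add p q _ _ hp hq => rw [mul_add]; exact V.add_mem hp hq
    | smul r p _ hp => rw [mul_smul_comm]; exact V.smul_mem _ hp
  rw [eq_top_iff]
  rintro p -
  induction p using Polynomial.induction_on' with
  | add p q hp hq => exact V.add_mem hp hq
  | monomial n r =>
    rw [← Polynomial.C_mul_X_pow_eq_monomial, ← Polynomial.smul_eq_C_mul]
    refine V.smul_mem _ ?_
    induction n with
    | zero => simpa [hermitePoly] using hmem 0
    | succ n ih => rw [pow_succ']; exact hX _ ih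

/-- The Hermite functions in the variable `y = s (x - a)`. -/
noncomputable def hermiteFun (s a : ℝ) (n : ℕ) (x : ℝ) : ℂ :=
  (polyGauss s a 2⁻¹ (hermitePoly n) x : ℂ)

theorem contDiff_hermiteFun (n : ℕ) {m : WithTop ℕ∞} : ContDiff ℝ m (hermiteFun s a n) :=
  Complex.ofRealCLM.contDiff.comp (contDiff_polyGauss _)

theorem memLp_hermiteFun (hs : s ≠ 0) (n : ℕ) : MemLp (hermiteFun s a n) 2 :=
  memLp_ofReal_polyGauss hs (by norm_num) _

theorem deriv_hermiteFun (n : ℕ) : deriv (hermiteFun s a n) = fun x =>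
    ((s * polyGauss s a 2⁻¹ (derivative (hermitePoly n) - X * hermitePoly n) x : ℝ) : ℂ) :=
  funext fun x => (hasDerivAt_polyGauss (hermitePoly n) x).ofReal_comp.deriv

theorem memLp_deriv_hermiteFun (hs : s ≠ 0) (n : ℕ) : MemLp (deriv (hermiteFun s a n)) 2 := by
  rw [deriv_hermiteFun]
  exact ((memLp_polyGauss hs (by norm_num) _).const_mul s).ofReal

/-- The left side is `h(k) - W` for `b = s ^ 2`, `k = s ^ 2 * a`, the parametrization used from here
on. -/
theorem hermiteFun_ode (n : ℕ) (x : ℝ) :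
    -deriv (deriv (hermiteFun s a n)) x + ((s ^ 4 * (x - a) ^ 2 : ℝ) : ℂ) * hermiteFun s a n x =
      (((2 * n + 1) * s ^ 2 : ℝ) : ℂ) * hermiteFun s a n x := by
  rw [deriv_hermiteFun]
  have h1 := ((hasDerivAt_polyGauss (s := s) (a := a)
    (derivative (hermitePoly n) - X * hermitePoly n) x).const_mul s).ofReal_comp.deriv
  rw [h1, hermiteFun, ← Complex.ofReal_neg, ← Complex.ofReal_mul, ← Complex.ofReal_add,
    ← Complex.ofReal_mul, Complex.ofReal_inj]
  simp only [Polynomial.derivative_sub, Polynomial.derivative_mul, hermitePoly_ode,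
    Polynomial.derivative_X, polyGauss, Polynomial.eval_sub, Polynomial.eval_mul,
    Polynomial.eval_X, Polynomial.eval_add, Polynomial.eval_one, Polynomial.eval_natCast,
    Polynomial.eval_ofNat]
  ring

theorem integral_polyGauss_mul_eq_zero (hs : s ≠ 0) {f : ℝ → ℂ} (hf : MemLp f 2)
    (h0 : ∀ n, ∫ x, hermiteFun s a n x * f x = 0) (p : Polynomial ℝ) :
    ∫ x, (polyGauss s a 2⁻¹ p x : ℂ) * f x = 0 := by
  have hint : ∀ p, Integrable (fun x => (polyGauss s a 2⁻¹ p x : ℂ) * f x) := fun p =>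
    (memLp_ofReal_polyGauss hs (by norm_num) p).integrable_mul hf
  have hp : p ∈ Submodule.span ℝ (Set.range hermitePoly) := by
    rw [span_hermitePoly]
    trivial
  induction hp using Submodule.span_induction with
  | mem p hp =>
    obtain ⟨n, rfl⟩ := hp
    exact h0 n
  | zero => simp [polyGauss]
  | add p q _ _ hp hq =>
    have : ∀ x, (polyGauss s a 2⁻¹ (p + q) x : ℂ) * f x =
        (polyGauss s a 2⁻¹ p x : ℂ) * f x + (polyGauss s a 2⁻¹ q x : ℂ) * f x := by
      intro x
      simp only [polyGauss, Polynomial.eval_add]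
      push_cast
      ring
    simp only [this]
    rw [integral_add (hint p) (hint q), hp, hq, add_zero]
  | smul r p _ hp =>
    have : ∀ x, (polyGauss s a 2⁻¹ (r • p) x : ℂ) * f x =
        (r : ℂ) * ((polyGauss s a 2⁻¹ p x : ℂ) * f x) := by
      intro x
      simp only [polyGauss, Polynomial.eval_smul, smul_eq_mul]
      push_cast
      ring
    simp only [this]
    rw [integral_const_mul, hp, mul_zero]

/-- Since `t|y| ≤ t² + y²/4`, half of the Gaussian exponent absorbs the exponential. This supplies
the dominating function in the completeness proof. -/
theorem memLp_exp_mul_gaussian (hs : s ≠ 0) (t : ℝ) :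
    MemLp (fun x => Real.exp (t * |s * (x - a)|) * Real.exp (-2⁻¹ * (s * (x - a)) ^ 2)) 2 := by
  have h1 := (memLp_polyGauss (a := a) hs (c := 4⁻¹) (by norm_num) 1).const_mul (Real.exp (t ^ 2))
  refine h1.mono (by fun_prop) (Filter.Eventually.of_forall fun x => ?_)
  simp only [polyGauss, Polynomial.eval_one, one_mul]
  rw [← Real.exp_add, ← Real.exp_add, Real.norm_of_nonneg (Real.exp_pos _).le,
    Real.norm_of_nonneg (Real.exp_pos _).le, Real.exp_le_exp]
  nlinarith [sq_nonneg (t - |s * (x - a)| / 2), sq_abs (s * (x - a))]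

/-- Completeness of the Hermite functions. -/
theorem ae_eq_zero_of_integral_hermiteFun_mul_eq_zero (hs : s ≠ 0) {f : ℝ → ℂ} (hf : MemLp f 2)
    (h0 : ∀ n, ∫ x, hermiteFun s a n x * f x = 0) : ∀ᵐ x, f x = 0 := by
  let G : ℝ → ℂ := fun x => (polyGauss s a 2⁻¹ 1 x : ℂ) * f x
  have hG : Integrable G := (memLp_ofReal_polyGauss hs (by norm_num) 1).integrable_mul hf
  -- Expand the exponential in powers of `s (x - a)`: each term is a polynomial times the Gaussian
  -- times `f`, hence integrates to zero.
  have key : ∀ t : ℝ, ∫ x : ℝ, Complex.exp (t * (s * (x - a)) * Complex.I) * G x = 0 := by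
    intro t
    set F : ℕ → ℝ → ℂ := fun n x => (((t : ℂ) * Complex.I) ^ n / n.factorial) *
      ((polyGauss s a 2⁻¹ (X ^ n) x : ℂ) * f x) with hFdef
    set B : ℕ → ℝ → ℝ := fun n x => (|t| * |s * (x - a)|) ^ n / n.factorial *
      (Real.exp (-2⁻¹ * (s * (x - a)) ^ 2) * ‖f x‖) with hBdef
    have hFm : ∀ n, AEStronglyMeasurable (F n) volume := fun n =>
      (((memLp_ofReal_polyGauss hs (by norm_num) (X ^ n)).integrable_mul hf).const_mul
        _).aestronglyMeasurable
    have hFB : ∀ n x, ‖F n x‖ ≤ B n x := by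
      intro n x
      refine le_of_eq ?_
      simp only [hFdef, hBdef, polyGauss, Polynomial.eval_pow, Polynomial.eval_X, norm_mul,
        norm_div, norm_pow, Complex.norm_real, Complex.norm_I, Complex.norm_natCast,
        Real.norm_eq_abs, Real.abs_exp, mul_pow, abs_mul]
      ring
    have hBs : ∀ x, HasSum (fun n => B n x)
        ((Real.exp (|t| * |s * (x - a)|) * Real.exp (-2⁻¹ * (s * (x - a)) ^ 2)) * ‖f x‖) := by
      intro x
      have h1 := (NormedSpace.expSeries_div_hasSum_exp (𝔸 := ℝ) (|t| * |s * (x - a)|)).mul_right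
        (Real.exp (-2⁻¹ * (s * (x - a)) ^ 2) * ‖f x‖)
      rwa [← Real.exp_eq_exp_ℝ, ← mul_assoc] at h1
    have hBi : Integrable (fun x => ∑' n, B n x) := by
      simp only [fun x => (hBs x).tsum_eq]
      exact (memLp_exp_mul_gaussian hs _).integrable_mul hf.norm
    have hFs : ∀ x : ℝ, HasSum (fun n => F n x)
        (Complex.exp (t * (s * (x - a)) * Complex.I) * G x) := by
      intro x
      have h1 := (NormedSpace.expSeries_div_hasSum_exp (𝔸 := ℂ)
        ((t : ℂ) * (s * (x - a)) * Complex.I)).mul_right (G x)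
      rw [← Complex.exp_eq_exp_ℂ] at h1
      have h2 : ∀ n, F n x = ((t : ℂ) * (s * (x - a)) * Complex.I) ^ n / n.factorial * G x := by
        intro n
        simp only [hFdef, G, polyGauss, Polynomial.eval_pow, Polynomial.eval_X,
          Polynomial.eval_one]
        push_cast
        simp only [mul_pow]
        ring
      simpa only [h2] using h1
    have hsum := hasSum_integral_of_dominated_convergence (μ := volume) B hFm
      (fun n => Filter.Eventually.of_forall (hFB n))
      (Filter.Eventually.of_forall fun x => (hBs x).summable) hBi
      (Filter.Eventually.of_forall hFs)
    refine hsum.unique ?_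
    have : ∀ n : ℕ, ∫ x, F n x = 0 := by
      intro n
      simp only [hFdef]
      rw [integral_const_mul, integral_polyGauss_mul_eq_zero hs hf h0, mul_zero]
    simp only [this]
    exact hasSum_zero
  have hF : ∀ᵐ x, G x = 0 := by
    refine ae_eq_zero_of_fourier_eq_zero hG (funext fun w => ?_)
    rw [Real.fourier_real_eq_integral_exp_smul]
    -- Up to a constant phase, the Fourier integral at `w` is `key` with `t = -2πw/s`.
    have h1 : ∀ x : ℝ, Complex.exp (↑(-2 * Real.pi * x * w) * Complex.I) • G x =
        Complex.exp (↑(-2 * Real.pi * a * w) * Complex.I) *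
        (Complex.exp (((-2 * Real.pi * w / s : ℝ) : ℂ) * (s * (x - a)) * Complex.I) * G x) := by
      intro x
      have hs' : (s : ℂ) ≠ 0 := Complex.ofReal_ne_zero.2 hs
      rw [← mul_assoc, ← Complex.exp_add, smul_eq_mul]
      congr 2
      push_cast
      field_simp
      ring
    simp only [h1]
    rw [integral_const_mul, key, mul_zero, Pi.zero_apply]
  filter_upwards [hF] with x hx
  rcases mul_eq_zero.1 hx with h | h
  · exfalso
    rw [Complex.ofReal_eq_zero, polyGauss, Polynomial.eval_one, one_mul] at h
    exact (Real.exp_pos _).ne' h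
  · exact h

/-! ### Tools in `L²(ℝ)` -/

open Filter Topology

theorem norm_sq_eq_integral (u : L2) : ‖u‖ ^ 2 = ∫ x, ‖u x‖ ^ 2 := by
  have h1 := L2.inner_def (𝕜 := ℂ) u u
  rw [inner_self_eq_norm_sq_to_K] at h1
  have h2 : ∀ x, inner ℂ (u x) (u x) = ((‖u x‖ ^ 2 : ℝ) : ℂ) := fun x => by
    rw [inner_self_eq_norm_sq_to_K]
    norm_cast
  simp only [h2] at h1
  have h3 : ∫ x, ((‖u x‖ ^ 2 : ℝ) : ℂ) = ((∫ x, ‖u x‖ ^ 2 : ℝ) : ℂ) := integral_ofReal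
  rw [h3] at h1
  refine Complex.ofReal_injective ?_
  rw [← h1]
  push_cast
  rfl

theorem norm_toLp_sq {f : ℝ → ℂ} (hf : MemLp f 2) : ‖hf.toLp f‖ ^ 2 = ∫ x, ‖f x‖ ^ 2 := by
  rw [norm_sq_eq_integral]
  refine integral_congr_ae ?_
  filter_upwards [hf.coeFn_toLp] with x hx
  rw [hx]

/-- Dominated convergence in `L²`. -/
theorem tendsto_toLp_of_dominated {F : ℕ → ℝ → ℂ} {G : ℝ → ℂ} {g : ℝ → ℝ}
    (hF : ∀ m, MemLp (F m) 2) (hG : MemLp G 2) (hg : MemLp g 2)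
    (hFg : ∀ m x, ‖F m x‖ ≤ g x) (hlim : ∀ x, Tendsto (fun m => F m x) atTop (𝓝 (G x))) :
    Tendsto (fun m => (hF m).toLp (F m)) atTop (𝓝 (hG.toLp G)) := by
  rw [tendsto_iff_norm_sub_tendsto_zero]
  have hGg : ∀ x, ‖G x‖ ≤ g x := fun x =>
    le_of_tendsto (hlim x).norm (Eventually.of_forall fun m => hFg m x)
  have h1 : Tendsto (fun m => ∫ x, ‖F m x - G x‖ ^ 2) atTop (𝓝 (∫ _ : ℝ, (0 : ℝ))) := by
    refine tendsto_integral_of_dominated_convergence (fun x => 4 * g x ^ 2)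
      (fun m => (((hF m).sub hG).norm.aestronglyMeasurable.pow 2))
      (hg.integrable_sq.const_mul 4) (fun m => Eventually.of_forall fun x => ?_)
      (Eventually.of_forall fun x => ?_)
    · rw [Real.norm_of_nonneg (by positivity)]
      have h2 : ‖F m x - G x‖ ≤ 2 * g x := by linarith [norm_sub_le (F m x) (G x), hFg m x, hGg x]
      nlinarith [norm_nonneg (F m x - G x)]
    · have := ((hlim x).sub_const (G x)).norm.pow 2
      simpa using this
  have h2 : ∀ m, ‖(hF m).toLp (F m) - hG.toLp G‖ = √(∫ x, ‖F m x - G x‖ ^ 2) := by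
    intro m
    rw [← MemLp.toLp_sub, ← Real.sqrt_sq (norm_nonneg _), norm_toLp_sq]
    rfl
  simp only [h2]
  simpa using h1.sqrt

/-- Multiplication by a bounded continuous real function on `L²(ℝ)`. -/
theorem exists_mulOp {W : ℝ → ℝ} (hW : Continuous W) {C : ℝ} (hC : ∀ x, |W x| ≤ C) :
    ∃ M : L2 →L[ℂ] L2, (∀ u : L2, M u =ᵐ[volume] fun x => (W x : ℂ) * u x) ∧
      (∀ u, ‖M u‖ ≤ C * ‖u‖) ∧ ∀ u v, inner ℂ (M u) v = inner ℂ u (M v) := by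
  have hC0 : 0 ≤ C := (abs_nonneg _).trans (hC 0)
  have hmem : ∀ u : L2, MemLp (fun x => (W x : ℂ) * u x) 2 := fun u =>
    (Lp.memLp u).of_le_mul (c := C)
      ((Complex.continuous_ofReal.comp hW).aestronglyMeasurable.mul (Lp.aestronglyMeasurable u))
      (Eventually.of_forall fun x => by
        rw [norm_mul, Complex.norm_real]
        gcongr
        exact hC x)
  let L : L2 →ₗ[ℂ] L2 :=
    { toFun := fun u => (hmem u).toLp _
      map_add' := fun u v => by
        rw [← MemLp.toLp_add]
        refine MemLp.toLp_congr _ _ ?_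
        filter_upwards [Lp.coeFn_add u v] with x hx
        rw [hx]
        simp only [Pi.add_apply]
        ring
      map_smul' := fun c u => by
        rw [RingHom.id_apply, ← MemLp.toLp_const_smul]
        refine MemLp.toLp_congr _ _ ?_
        filter_upwards [Lp.coeFn_smul c u] with x hx
        rw [hx]
        simp only [Pi.smul_apply, smul_eq_mul]
        ring }
  have hL : ∀ u, L u =ᵐ[volume] fun x => (W x : ℂ) * u x := fun u => (hmem u).coeFn_toLp
  have hbound : ∀ u, ‖L u‖ ≤ C * ‖u‖ := fun u => by
    refine Lp.norm_le_mul_norm_of_ae_le_mul ?_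
    filter_upwards [hL u] with x hx
    rw [hx, norm_mul, Complex.norm_real]
    gcongr
    exact hC x
  refine ⟨L.mkContinuous C hbound, hL, hbound, fun u v => ?_⟩
  change inner ℂ (L u) v = inner ℂ u (L v)
  rw [L2.inner_def, L2.inner_def]
  refine integral_congr_ae ?_
  filter_upwards [hL u, hL v] with x h1 h2
  rw [h1, h2]
  simp only [RCLike.inner_apply, map_mul, Complex.conj_ofReal]
  ring

theorem integral_mul_deriv_deriv {f φ : ℝ → ℂ} (hf : ContDiff ℝ ∞ f) (hφ : ContDiff ℝ ∞ φ)
    (hc : HasCompactSupport φ) :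
    ∫ x, f x * deriv (deriv φ) x = ∫ x, deriv (deriv f) x * φ x := by
  have f1 : ContDiff ℝ ∞ (deriv f) := (contDiff_infty_iff_deriv.1 hf).2
  have f2 : ContDiff ℝ ∞ (deriv (deriv f)) := (contDiff_infty_iff_deriv.1 f1).2
  have φ1 : ContDiff ℝ ∞ (deriv φ) := (contDiff_infty_iff_deriv.1 hφ).2
  have φ2 : ContDiff ℝ ∞ (deriv (deriv φ)) := (contDiff_infty_iff_deriv.1 φ1).2
  have hder : ∀ {g : ℝ → ℂ}, ContDiff ℝ ∞ g → ∀ x, HasDerivAt g (deriv g x) x := fun hg x =>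
    (hg.differentiable (by simp) x).hasDerivAt
  have hint : ∀ {g ψ : ℝ → ℂ}, ContDiff ℝ ∞ g → ContDiff ℝ ∞ ψ → HasCompactSupport ψ →
      Integrable (g * ψ) := fun hg hψ hs =>
    (hg.continuous.mul hψ.continuous).integrable_of_hasCompactSupport hs.mul_left
  have h1 := integral_mul_deriv_eq_deriv_mul_of_integrable (fun x _ => hder hf x)
    (fun x _ => hder φ1 x) (hint hf φ2 hc.deriv.deriv) (hint f1 φ1 hc.deriv)
    (hint hf φ1 hc.deriv)
  have h2 := integral_mul_deriv_eq_deriv_mul_of_integrable (fun x _ => hder f1 x)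
    (fun x _ => hder hφ x) (hint f1 φ1 hc.deriv) (hint f2 hφ hc) (hint f1 hφ hc)
  rw [h1, h2, neg_neg]

/-! ### The Hermite basis and the closed operator -/

/-- The Hermite functions as (non-normalized) elements of `L²(ℝ)`. -/
noncomputable def hermiteVec (hs : s ≠ 0) (a : ℝ) (n : ℕ) : L2 :=
  (memLp_hermiteFun (a := a) hs n).toLp _

theorem hermiteVec_coe (hs : s ≠ 0) (a : ℝ) (n : ℕ) :
    hermiteVec hs a n =ᵐ[volume] hermiteFun s a n := MemLp.coeFn_toLp _

theorem inner_hermiteVec (hs : s ≠ 0) (a : ℝ) (n : ℕ) (u : L2) :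
    inner ℂ (hermiteVec hs a n) u = ∫ x, hermiteFun s a n x * u x := by
  rw [L2.inner_def]
  refine integral_congr_ae ?_
  filter_upwards [hermiteVec_coe hs a n] with x hx
  rw [hx, RCLike.inner_apply, hermiteFun, Complex.conj_ofReal, mul_comm]

theorem hermiteVec_ne_zero (hs : s ≠ 0) (a : ℝ) (n : ℕ) : hermiteVec hs a n ≠ 0 := by
  intro h0
  have h1 := hermiteVec_coe hs a n
  rw [h0] at h1
  have h2 : hermiteFun s a n = 0 := ((contDiff_hermiteFun (m := 0) n).continuous.ae_eq_iff_eq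
    volume continuous_const).1 (h1.symm.trans (Lp.coeFn_zero ℂ 2 volume))
  refine hermitePoly_ne_zero n (Polynomial.funext fun y => ?_)
  have h3 := congrFun h2 (y / s + a)
  rw [hermiteFun, Pi.zero_apply, Complex.ofReal_eq_zero, polyGauss] at h3
  have h4 := (mul_eq_zero.1 h3).resolve_right (Real.exp_pos _).ne'
  rwa [add_sub_cancel_right, mul_div_cancel₀ _ hs, ← Polynomial.eval_zero (x := y)] at h4

theorem eq_zero_of_inner_hermiteVec (hs : s ≠ 0) {u : L2}
    (h0 : ∀ n, inner ℂ (hermiteVec hs a n) u = 0) : u = 0 := by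
  have h1 := ae_eq_zero_of_integral_hermiteFun_mul_eq_zero (a := a) hs (Lp.memLp u)
    fun n => by rw [← inner_hermiteVec hs, h0]
  exact Lp.ext (EventuallyEq.trans h1 (Lp.coeFn_zero ℂ 2 volume).symm)

/-- Symmetry of `h(k) - W` against the Hermite functions. -/
theorem inner_hermiteVec_testGraph (hs : s ≠ 0) {W : ℝ → ℝ} {M : L2 →L[ℂ] L2}
    (hM : ∀ u : L2, M u =ᵐ[volume] fun x => (W x : ℂ) * u x) (n : ℕ) {p : L2 × L2}
    (hp : p ∈ testGraph (s ^ 2) W (s ^ 2 * a)) :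
    inner ℂ (hermiteVec hs a n) (p.2 - M p.1) =
      (((2 * n + 1) * s ^ 2 : ℝ) : ℂ) * inner ℂ (hermiteVec hs a n) p.1 := by
  obtain ⟨φ, hφ, hc, h1, h2⟩ := hp
  rw [inner_hermiteVec, inner_hermiteVec, ← integral_const_mul]
  have hf : ContDiff ℝ ∞ (hermiteFun s a n) := contDiff_hermiteFun n
  have f2 : ContDiff ℝ ∞ (deriv (deriv (hermiteFun s a n))) :=
    (contDiff_infty_iff_deriv.1 (contDiff_infty_iff_deriv.1 hf).2).2
  have φ2 : ContDiff ℝ ∞ (deriv (deriv φ)) :=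
    (contDiff_infty_iff_deriv.1 (contDiff_infty_iff_deriv.1 hφ).2).2
  have hint : ∀ {g ψ : ℝ → ℂ}, Continuous g → Continuous ψ → HasCompactSupport ψ →
      Integrable (fun x => g x * ψ x) := fun hg hψ hs =>
    (hg.mul hψ).integrable_of_hasCompactSupport hs.mul_left
  let V : ℝ → ℂ := fun x => ((s ^ 4 * (x - a) ^ 2 : ℝ) : ℂ)
  have hV : Continuous V := by fun_prop
  have i1 := hint hf.continuous φ2.continuous hc.deriv.deriv
  have i2 := hint f2.continuous hφ.continuous hc
  have i3 := hint (hV.mul hf.continuous) hφ.continuous hc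
  have e1 : ∫ x, hermiteFun s a n x * (p.2 - M p.1) x =
      ∫ x, (V x * hermiteFun s a n x * φ x - hermiteFun s a n x * deriv (deriv φ) x) := by
    refine integral_congr_ae ?_
    filter_upwards [h1, h2, hM p.1, Lp.coeFn_sub p.2 (M p.1)] with x g1 g2 g3 g4
    rw [g4, Pi.sub_apply, g3, g2, g1, hExpr]
    simp only [V]
    push_cast
    ring
  have e2 : ∫ x, (((2 * n + 1) * s ^ 2 : ℝ) : ℂ) * (hermiteFun s a n x * p.1 x) =
      ∫ x, (V x * hermiteFun s a n x * φ x - deriv (deriv (hermiteFun s a n)) x * φ x) := by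
    refine integral_congr_ae ?_
    filter_upwards [h1] with x g1
    rw [g1, ← mul_assoc, ← hermiteFun_ode]
    simp only [V]
    ring
  rw [e1, e2, integral_sub, integral_sub, integral_mul_deriv_deriv hf hφ hc]
  exacts [i3, i2, i3, i1]

/-- Both sides are continuous in `p`, so the identity survives closure of the graph. -/
theorem inner_hermiteVec_closure (hs : s ≠ 0) {W : ℝ → ℝ} {M : L2 →L[ℂ] L2}
    (hM : ∀ u : L2, M u =ᵐ[volume] fun x => (W x : ℂ) * u x) (n : ℕ) {p : L2 × L2}
    (hp : p ∈ (testGraph (s ^ 2) W (s ^ 2 * a)).topologicalClosure) :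
    inner ℂ (hermiteVec hs a n) (p.2 - M p.1) =
      (((2 * n + 1) * s ^ 2 : ℝ) : ℂ) * inner ℂ (hermiteVec hs a n) p.1 := by
  have hcl : IsClosed {p : L2 × L2 | inner ℂ (hermiteVec hs a n) (p.2 - M p.1) =
      (((2 * n + 1) * s ^ 2 : ℝ) : ℂ) * inner ℂ (hermiteVec hs a n) p.1} :=
    isClosed_eq (by fun_prop) (by fun_prop)
  exact closure_minimal (fun p hp => inner_hermiteVec_testGraph hs hM n hp) hcl hp

theorem deriv_deriv_cutoff_mul {ρ : ℝ → ℝ} {f : ℝ → ℂ} (hρ : ContDiff ℝ ∞ ρ)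
    (hf : ContDiff ℝ ∞ f) (c x : ℝ) :
    deriv (deriv fun x => (ρ (c * x) : ℂ) * f x) x =
      ((c ^ 2 * deriv (deriv ρ) (c * x) : ℝ) : ℂ) * f x +
        ((2 * c * deriv ρ (c * x) : ℝ) : ℂ) * deriv f x + (ρ (c * x) : ℂ) * deriv (deriv f) x := by
  have f1 : ContDiff ℝ ∞ (deriv f) := (contDiff_infty_iff_deriv.1 hf).2
  have ρ1 : ContDiff ℝ ∞ (deriv ρ) := (contDiff_infty_iff_deriv.1 hρ).2
  have hd : ∀ {g : ℝ → ℂ}, ContDiff ℝ ∞ g → ∀ x, HasDerivAt g (deriv g x) x := fun hg x =>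
    (hg.differentiable (by simp) x).hasDerivAt
  have hr : ∀ {g : ℝ → ℝ}, ContDiff ℝ ∞ g → ∀ x,
      HasDerivAt (fun x => (g (c * x) : ℂ)) ((deriv g (c * x) * c : ℝ) : ℂ) x := fun {g} hg x =>
    ((hg.differentiable (by simp) (c * x)).hasDerivAt.comp (h := fun x => c * x) x
      (by simpa using (hasDerivAt_id x).const_mul c)).ofReal_comp
  have h1 : (deriv fun x => (ρ (c * x) : ℂ) * f x) = fun x =>
      ((deriv ρ (c * x) * c : ℝ) : ℂ) * f x + (ρ (c * x) : ℂ) * deriv f x :=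
    funext fun x => ((hr hρ x).mul (hd hf x)).deriv
  have h2 : HasDerivAt (fun x => ((deriv ρ (c * x) * c : ℝ) : ℂ))
      (((deriv (deriv ρ) (c * x) * c : ℝ) : ℂ) * c) x := by
    simpa using (hr ρ1 x).mul_const (c : ℂ)
  rw [h1]
  refine ((h2.mul (hd hf x)).add ((hr hρ x).mul (hd f1 x))).deriv.trans ?_
  push_cast
  ring

/-- The Hermite functions belong to the domain of the closure of `h(k)`. -/
theorem hermiteVec_mem_closure (hs : s ≠ 0) {W : ℝ → ℝ} (hW : Continuous W) {C : ℝ}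
    (hC : ∀ x, |W x| ≤ C) {M : L2 →L[ℂ] L2}
    (hM : ∀ u : L2, M u =ᵐ[volume] fun x => (W x : ℂ) * u x) (n : ℕ) :
    (hermiteVec hs a n, (((2 * n + 1) * s ^ 2 : ℝ) : ℂ) • hermiteVec hs a n +
      M (hermiteVec hs a n)) ∈ (testGraph (s ^ 2) W (s ^ 2 * a)).topologicalClosure := by
  let ρ : ContDiffBump (0 : ℝ) := ⟨1, 2, one_pos, one_lt_two⟩
  have hρ : ContDiff ℝ ∞ ρ := ρ.contDiff
  have ρ1 : ContDiff ℝ ∞ (deriv ρ) := (contDiff_infty_iff_deriv.1 hρ).2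
  have ρ2 : ContDiff ℝ ∞ (deriv (deriv ρ)) := (contDiff_infty_iff_deriv.1 ρ1).2
  obtain ⟨K1, hK1⟩ := ρ.hasCompactSupport.deriv.exists_bound_of_continuous ρ1.continuous
  obtain ⟨K2, hK2⟩ := ρ.hasCompactSupport.deriv.deriv.exists_bound_of_continuous ρ2.continuous
  have hK10 : 0 ≤ K1 := (norm_nonneg _).trans (hK1 0)
  have hK20 : 0 ≤ K2 := (norm_nonneg _).trans (hK2 0)
  set f := hermiteFun s a n with hfdef
  set lam : ℝ := (2 * n + 1) * s ^ 2 with hlam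
  have hf : ContDiff ℝ ∞ f := contDiff_hermiteFun n
  have hf2 : MemLp f 2 := memLp_hermiteFun hs n
  have hf2' : MemLp (deriv f) 2 := memLp_deriv_hermiteFun hs n
  let c : ℕ → ℝ := fun m => 1 / ((m : ℝ) + 1)
  have hc0 : ∀ m, 0 < c m := fun m => by positivity
  have hc1 : ∀ m, c m ≤ 1 := fun m => by
    simp only [c]
    rw [div_le_one (by positivity)]
    linarith [Nat.cast_nonneg (α := ℝ) m]
  have hclim : Tendsto c atTop (𝓝 0) := tendsto_one_div_add_atTop_nhds_zero_nat
  let Φ : ℕ → ℝ → ℂ := fun m x => (ρ (c m * x) : ℂ) * f x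
  let T : ℝ → ℂ := fun x => ((lam + W x : ℝ) : ℂ) * f x
  have hΦ : ∀ m, ContDiff ℝ ∞ (Φ m) := fun m =>
    (Complex.ofRealCLM.contDiff.comp (hρ.comp (contDiff_const.mul contDiff_id))).mul hf
  have hΦc : ∀ m, HasCompactSupport (Φ m) := fun m => by
    have h1 : HasCompactSupport (fun x => (ρ (c m * x) : ℂ)) :=
      (ρ.hasCompactSupport.comp_homeomorph (Homeomorph.mulLeft₀ (c m) (hc0 m).ne')).comp_left
        (g := Complex.ofReal) (by simp)
    exact h1.mul_right
  -- The eigenvalue equation removes `f''`; the remaining commutator terms carry a factor `c m` or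
  -- `c m ^ 2` and vanish in the limit.
  have hexpr : ∀ m x, hExpr (s ^ 2) W (s ^ 2 * a) (Φ m) x = (ρ (c m * x) : ℂ) * T x -
      ((c m ^ 2 * deriv (deriv ρ) (c m * x) : ℝ) : ℂ) * f x -
        ((2 * c m * deriv ρ (c m * x) : ℝ) : ℂ) * deriv f x := by
    intro m x
    have h1 := hermiteFun_ode (s := s) (a := a) n x
    rw [← hfdef, ← hlam] at h1
    rw [hExpr, deriv_deriv_cutoff_mul hρ hf]
    simp only [T, Φ]
    push_cast at h1 ⊢
    linear_combination (ρ (c m * x) : ℂ) * h1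
  have hTm : MemLp T 2 := by
    refine hf2.of_le_mul (c := |lam| + C)
      ((Complex.continuous_ofReal.comp (continuous_const.add hW)).mul
        hf.continuous).aestronglyMeasurable (Eventually.of_forall fun x => ?_)
    rw [norm_mul, Complex.norm_real, Real.norm_eq_abs]
    gcongr
    exact (abs_add_le _ _).trans (by linarith [hC x])
  have hΦm : ∀ m, MemLp (Φ m) 2 := fun m =>
    (hΦ m).continuous.memLp_of_hasCompactSupport (hΦc m)
  have hρ1 : ∀ x, |ρ x| ≤ 1 := fun x => by
    rw [abs_of_nonneg ρ.nonneg]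
    exact ρ.le_one
  have hΦb : ∀ m x, ‖Φ m x‖ ≤ ‖f x‖ := fun m x => by
    rw [norm_mul, Complex.norm_real, Real.norm_eq_abs]
    exact mul_le_of_le_one_left (norm_nonneg _) (hρ1 _)
  have hEb : ∀ m x, ‖hExpr (s ^ 2) W (s ^ 2 * a) (Φ m) x‖ ≤
      ‖T x‖ + K2 * ‖f x‖ + 2 * K1 * ‖deriv f x‖ := by
    intro m x
    rw [hexpr]
    refine (norm_sub_le _ _).trans (add_le_add ((norm_sub_le _ _).trans (add_le_add ?_ ?_)) ?_)
    · rw [norm_mul, Complex.norm_real, Real.norm_eq_abs]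
      exact mul_le_of_le_one_left (norm_nonneg _) (hρ1 _)
    · rw [norm_mul, Complex.norm_real, norm_mul, norm_pow, Real.norm_of_nonneg (hc0 m).le]
      gcongr
      calc c m ^ 2 * ‖deriv (deriv ρ) (c m * x)‖ ≤ 1 * K2 := by
            gcongr
            · exact pow_le_one₀ (hc0 m).le (hc1 m)
            · exact hK2 _
        _ = K2 := one_mul _
    · rw [norm_mul, Complex.norm_real, norm_mul, norm_mul, Real.norm_of_nonneg (hc0 m).le,
        Real.norm_of_nonneg zero_le_two]
      refine mul_le_mul_of_nonneg_right ?_ (norm_nonneg _)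
      calc 2 * c m * ‖deriv ρ (c m * x)‖ ≤ 2 * 1 * K1 := by
            gcongr
            · exact hc1 m
            · exact hK1 _
        _ = 2 * K1 := by ring
  have hgE : MemLp (fun x => ‖T x‖ + K2 * ‖f x‖ + 2 * K1 * ‖deriv f x‖) 2 :=
    (hTm.norm.add (hf2.norm.const_mul K2)).add (hf2'.norm.const_mul (2 * K1))
  have hEcont : ∀ m, Continuous (hExpr (s ^ 2) W (s ^ 2 * a) (Φ m)) := fun m => by
    have h1 := ((contDiff_infty_iff_deriv.1 (contDiff_infty_iff_deriv.1 (hΦ m)).2).2).continuous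
    have h2 := (hΦ m).continuous
    unfold hExpr
    fun_prop
  have hEm : ∀ m, MemLp (hExpr (s ^ 2) W (s ^ 2 * a) (Φ m)) 2 := fun m =>
    hgE.mono (hEcont m).aestronglyMeasurable (Eventually.of_forall fun x =>
      (hEb m x).trans (le_abs_self _))
  have hcx : ∀ x, Tendsto (fun m => c m * x) atTop (𝓝 0) := fun x => by
    simpa using hclim.mul_const x
  have hρlim : ∀ x, Tendsto (fun m => (ρ (c m * x) : ℂ)) atTop (𝓝 1) := fun x => by
    have h1 := (hρ.continuous.tendsto 0).comp (hcx x)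
    rw [ρ.one_of_mem_closedBall (Metric.mem_closedBall_self ρ.rIn_pos.le)] at h1
    exact_mod_cast (Complex.continuous_ofReal.tendsto 1).comp h1
  have l1 := tendsto_toLp_of_dominated hΦm hf2 hf2.norm hΦb fun x => by
    simpa using (hρlim x).mul_const (f x)
  have l2 := tendsto_toLp_of_dominated hEm hTm hgE hEb fun x => by
    simp only [hexpr]
    have t1 := (hρlim x).mul_const (T x)
    have t2 : Tendsto (fun m => ((c m ^ 2 * deriv (deriv ρ) (c m * x) : ℝ) : ℂ) * f x) atTop
        (𝓝 0) := by
      have h1 := (hclim.pow 2).mul ((ρ2.continuous.tendsto 0).comp (hcx x))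
      simpa using ((Complex.continuous_ofReal.tendsto _).comp h1).mul_const (f x)
    have t3 : Tendsto (fun m => ((2 * c m * deriv ρ (c m * x) : ℝ) : ℂ) * deriv f x) atTop
        (𝓝 0) := by
      have h1 := (hclim.const_mul 2).mul ((ρ1.continuous.tendsto 0).comp (hcx x))
      simpa using ((Complex.continuous_ofReal.tendsto _).comp h1).mul_const (deriv f x)
    simpa using (t1.sub t2).sub t3
  have hTeq : (lam : ℂ) • hermiteVec hs a n + M (hermiteVec hs a n) = hTm.toLp T := by
    refine Lp.ext ?_
    filter_upwards [Lp.coeFn_add ((lam : ℂ) • hermiteVec hs a n) (M (hermiteVec hs a n)),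
      Lp.coeFn_smul (lam : ℂ) (hermiteVec hs a n), hM (hermiteVec hs a n),
      hermiteVec_coe hs a n, hTm.coeFn_toLp] with x g1 g2 g3 g4 g5
    rw [g1, Pi.add_apply, g2, Pi.smul_apply, g3, g4, g5]
    simp only [T, smul_eq_mul]
    push_cast
    ring
  rw [hTeq]
  refine mem_closure_of_tendsto (l1.prodMk_nhds l2) (Eventually.of_forall fun m => ?_)
  exact ⟨Φ m, hΦ m, hΦc m, (hΦm m).coeFn_toLp, (hEm m).coeFn_toLp⟩

/-- Take `W = 0`: one Hermite vector is tested against another that lies in the domain of the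
closure, and the levels differ. -/
theorem inner_hermiteVec_of_ne (hs : s ≠ 0) {m n : ℕ} (hmn : m ≠ n) :
    inner ℂ (hermiteVec hs a m) (hermiteVec hs a n) = 0 := by
  have hM : ∀ u : L2, (0 : L2 →L[ℂ] L2) u =ᵐ[volume] fun x => (((0 : ℝ → ℝ) x : ℝ) : ℂ) * u x := by
    intro u
    rw [zero_apply]
    filter_upwards [Lp.coeFn_zero ℂ 2 volume] with x hx
    rw [hx]
    simp
  have h1 := inner_hermiteVec_closure hs hM m
    (hermiteVec_mem_closure (a := a) hs (W := 0) continuous_const (C := 0)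
      (fun x => by simp) hM n)
  simp only [zero_apply, add_zero, sub_zero, inner_smul_right] at h1
  rw [← sub_eq_zero, ← sub_mul, mul_eq_zero, sub_eq_zero, Complex.ofReal_inj] at h1
  refine h1.resolve_left fun h2 => hmn ?_
  have h3 := mul_right_cancel₀ (pow_ne_zero 2 hs) h2
  exact_mod_cast (show (m : ℝ) = n by linarith)

/-- The normalized Hermite functions form an orthonormal basis of `L²(ℝ)`. -/
theorem exists_hermiteBasis (hs : s ≠ 0) (a : ℝ) : ∃ φ : HilbertBasis ℕ ℂ L2,
    ∀ n, φ n = ((‖hermiteVec hs a n‖⁻¹ : ℝ) : ℂ) • hermiteVec hs a n := by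
  have hpos : ∀ n, ‖hermiteVec hs a n‖ ≠ 0 := fun n => norm_ne_zero_iff.2 (hermiteVec_ne_zero hs a n)
  let v : ℕ → L2 := fun n => ((‖hermiteVec hs a n‖⁻¹ : ℝ) : ℂ) • hermiteVec hs a n
  have hv : Orthonormal ℂ v := by
    refine ⟨fun n => ?_, fun m n hmn => ?_⟩
    · rw [norm_smul, Complex.norm_real, norm_inv, norm_norm, inv_mul_cancel₀ (hpos n)]
    · change inner ℂ (v m) (v n) = 0
      rw [inner_smul_left, inner_smul_right, inner_hermiteVec_of_ne hs hmn, mul_zero, mul_zero]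
  have hbot : (Submodule.span ℂ (Set.range v))ᗮ = ⊥ := by
    rw [Submodule.eq_bot_iff]
    intro u hu
    refine eq_zero_of_inner_hermiteVec (a := a) hs fun n => ?_
    have h1 := (Submodule.mem_orthogonal _ _).1 hu (v n) (Submodule.subset_span ⟨n, rfl⟩)
    rw [inner_smul_left, mul_eq_zero] at h1
    refine h1.resolve_left ?_
    rw [Complex.conj_ofReal]
    exact Complex.ofReal_ne_zero.2 (inv_ne_zero (hpos n))
  exact ⟨HilbertBasis.mkOfOrthogonalEqBot hv hbot, fun n => by
    rw [HilbertBasis.coe_mkOfOrthogonalEqBot]⟩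

/-! ### Eigenvalues in coordinates -/

section Spectrum

variable {hs : s ≠ 0} {W : ℝ → ℝ} {C : ℝ} {M : L2 →L[ℂ] L2} {φ : HilbertBasis ℕ ℂ L2}

/-- The closure of `h(k)` is `D + W`, with `D` diagonal in the Hermite basis. -/
theorem mem_closure_testGraph_iff (hW : Continuous W) (hC : ∀ x, |W x| ≤ C)
    (hM : ∀ u : L2, M u =ᵐ[volume] fun x => (W x : ℂ) * u x)
    (hφ : ∀ n, φ n = ((‖hermiteVec hs a n‖⁻¹ : ℝ) : ℂ) • hermiteVec hs a n) (p : L2 × L2) :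
    p ∈ (testGraph (s ^ 2) W (s ^ 2 * a)).topologicalClosure ↔
      ∀ n : ℕ, inner ℂ (φ n) (p.2 - M p.1) =
        (((2 * n + 1) * s ^ 2 : ℝ) : ℂ) * inner ℂ (φ n) p.1 := by
  set G := (testGraph (s ^ 2) W (s ^ 2 * a)).topologicalClosure
  constructor
  · intro hp n
    rw [hφ, inner_smul_left, inner_smul_left, inner_hermiteVec_closure hs hM n hp]
    ring
  · intro hp
    have hmem : ∀ n : ℕ,
        (φ n, (((2 * n + 1) * s ^ 2 : ℝ) : ℂ) • φ n + M (φ n)) ∈ G := by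
      intro n
      have h1 := G.smul_mem ((‖hermiteVec hs a n‖⁻¹ : ℝ) : ℂ)
        (hermiteVec_mem_closure (a := a) hs hW hC hM n)
      rw [hφ, map_smul, smul_comm, ← smul_add]
      exact h1
    have h1 : HasSum (fun n => inner ℂ (φ n) p.1 • φ n) p.1 := by
      simpa only [φ.repr_apply_apply] using φ.hasSum_repr p.1
    have h2 : HasSum (fun n => inner ℂ (φ n) (p.2 - M p.1) • φ n) (p.2 - M p.1) := by
      simpa only [φ.repr_apply_apply] using φ.hasSum_repr (p.2 - M p.1)
    have h3 := h2.add (M.hasSum h1)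
    rw [sub_add_cancel] at h3
    -- The partial sums of the expansions of both components are combinations of graph elements
    -- `hmem n`, and the graph is closed.
    refine (Submodule.isClosed_topologicalClosure _).mem_of_tendsto (h1.prodMk h3)
      (Eventually.of_forall fun t => ?_)
    refine G.sum_mem fun n _ => ?_
    convert G.smul_mem (inner ℂ (φ n) p.1) (hmem n) using 1
    rw [Prod.smul_mk, hp, map_smul, smul_add, smul_smul, mul_comm]

/-- The coefficient description also gives closability: a zero first component forces all
coefficients of the second to vanish. So the graph of `h(k)` really is the closure of `testGraph`.
-/
theorem eigenvalues_eq (hW : Continuous W) (hC : ∀ x, |W x| ≤ C)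
    (hM : ∀ u : L2, M u =ᵐ[volume] fun x => (W x : ℂ) * u x)
    (hφ : ∀ n, φ n = ((‖hermiteVec hs a n‖⁻¹ : ℝ) : ℂ) • hermiteVec hs a n) :
    eigenvalues (s ^ 2) W (s ^ 2 * a) =
      {e : ℝ | ∃ u ≠ 0, DiagEigen φ (fun n => (2 * n + 1) * s ^ 2) M (e : ℂ) u} := by
  have hmem := mem_closure_testGraph_iff hW hC hM hφ
  have hcl : (hMin (s ^ 2) W (s ^ 2 * a)).IsClosable := by
    refine ⟨(testGraph (s ^ 2) W (s ^ 2 * a)).topologicalClosure.toLinearPMap, ?_⟩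
    rw [hMin_graph, Submodule.toLinearPMap_graph_eq]
    rintro ⟨u, g⟩ hp (rfl : u = 0)
    refine eq_of_coeff_eq φ fun n => ?_
    simpa using (hmem _).1 hp n
  have hgraph : (h (s ^ 2) W (s ^ 2 * a)).graph =
      (testGraph (s ^ 2) W (s ^ 2 * a)).topologicalClosure := by
    rw [h, ← hcl.graph_closure_eq_closure_graph, hMin_graph]
  have hiff : ∀ (e : ℝ) (u : L2), (u, (e : ℂ) • u) ∈ (h (s ^ 2) W (s ^ 2 * a)).graph ↔
      DiagEigen φ (fun n => (2 * n + 1) * s ^ 2) M (e : ℂ) u := by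
    intro e u
    rw [hgraph, hmem]
    refine forall_congr' fun n => ?_
    rw [inner_sub_right, inner_smul_right, sub_eq_iff_eq_add', ← sub_eq_iff_eq_add, ← sub_mul]
  ext e
  constructor
  · rintro ⟨u, hu, he⟩
    refine ⟨u, fun h0 => hu (Subtype.ext h0), (hiff e u).1 ?_⟩
    rw [← he]
    exact LinearPMap.mem_graph _ u
  · rintro ⟨u, hu, he⟩
    obtain ⟨v, hv1, hv2⟩ := (LinearPMap.mem_graph_iff _).1 ((hiff e u).2 he)
    simp only at hv1 hv2
    refine ⟨v, fun h0 => hu ?_, ?_⟩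
    · rw [← hv1, h0]
      rfl
    · rw [hv2, hv1]

end Spectrum

/-- For a bounded potential and a strong magnetic field there is exactly one eigenvalue near each
Landau level. -/
theorem exists_eigenvalue_seq {W : ℝ → ℝ} (hW : Continuous W) {C : ℝ} (hC0 : 0 < C)
    (hC : ∀ x, |W x| ≤ C) (hs : s ≠ 0) (hsC : 10 * C ≤ s ^ 2) (a : ℝ) :
    ∃ e : ℕ → ℝ, StrictMono e ∧ eigenvalues (s ^ 2) W (s ^ 2 * a) = Set.range e ∧
      (∀ n : ℕ, |e n - (2 * n + 1) * s ^ 2| ≤ 2 * C) ∧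
      ∀ (n : ℕ) (M : L2 →L[ℂ] L2) (w δ : ℝ),
        (∀ u : L2, M u =ᵐ[volume] fun x => (W x : ℂ) * u x) →
        ‖M (hermiteVec hs a n) - (w : ℂ) • hermiteVec hs a n‖ ≤ δ * ‖hermiteVec hs a n‖ →
        |e n - (2 * n + 1) * s ^ 2 - w| ≤ 2 * δ := by
  obtain ⟨M, hM, hMC, hsym⟩ := exists_mulOp hW hC
  obtain ⟨φ, hφ⟩ := exists_hermiteBasis hs a
  set lam : ℕ → ℝ := fun n => (2 * n + 1) * s ^ 2 with hlam
  have hgap : ∀ n m, n ≠ m → 20 * C ≤ |lam n - lam m| := by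
    intro n m hnm
    have h1 : lam n - lam m = (((n : ℤ) - m : ℤ) : ℝ) * (2 * s ^ 2) := by
      simp only [hlam]
      push_cast
      ring
    have h2 : (1 : ℝ) ≤ |(((n : ℤ) - m : ℤ) : ℝ)| := by
      have h3 : (n : ℤ) - m ≠ 0 := sub_ne_zero.2 (Nat.cast_injective.ne hnm)
      rw [← Int.cast_abs, ← Int.cast_one, Int.cast_le]
      exact Int.one_le_abs h3
    rw [h1, abs_mul, abs_of_nonneg (by positivity : 0 ≤ 2 * s ^ 2)]
    nlinarith [sq_nonneg s]
  choose e u hu he hen using fun n => exists_diagEigen (φ := φ) n hC0 hMC hsym hgap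
  refine ⟨e, strictMono_nat_of_lt_succ fun n => ?_, ?_, hen, fun n M' w δ hM' hδ => ?_⟩
  · have h1 := abs_le.1 (hen n)
    have h2 := abs_le.1 (hen (n + 1))
    simp only [hlam] at h1 h2
    push_cast at h2
    nlinarith [h1.2, h2.1]
  · rw [eigenvalues_eq hW hC hM hφ]
    ext x
    constructor
    · rintro ⟨v, hv, hx⟩
      -- Any eigenvalue is near some level, and the one near that level is unique.
      obtain ⟨n, hn⟩ := hx.exists_near hC0 hMC hv
      exact ⟨n, (he n).unique hC0 hMC hsym hgap (hu n) hv hx (hen n) hn⟩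
    · rintro ⟨n, rfl⟩
      exact ⟨u n, hu n, he n⟩
  · have hMM : M' = M := ContinuousLinearMap.ext fun u => Lp.ext ((hM' u).trans (hM u).symm)
    subst hMM
    refine (he n).abs_sub_le hC0 hMC hsym hgap (hu n) (hen n) ?_
    have hpos : 0 < ‖hermiteVec hs a n‖ := norm_pos_iff.2 (hermiteVec_ne_zero hs a n)
    rw [hφ, map_smul, smul_comm, ← smul_sub, norm_smul, Complex.norm_real, norm_inv, norm_norm,
      inv_mul_le_iff₀ hpos, mul_comm]
    exact hδ

/-! ### Localization of Hermite functions -/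

theorem integral_polyGauss_sq (hs : 0 < s) (c : ℝ) (p : Polynomial ℝ) :
    ∫ x, polyGauss s a c p x ^ 2 = s⁻¹ * ∫ x, polyGauss 1 0 c p x ^ 2 := by
  have h1 : ∀ x, polyGauss s a c p x ^ 2 =
      (fun y => (fun z => polyGauss 1 0 c p z ^ 2) (s * y)) (x - a) := by
    intro x
    simp [polyGauss]
  simp only [h1]
  rw [integral_sub_right_eq_self (fun y => polyGauss 1 0 c p (s * y) ^ 2) a,
    Measure.integral_comp_mul_left (fun z => polyGauss 1 0 c p z ^ 2) s, smul_eq_mul,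
    abs_of_pos (inv_pos.2 hs)]

/-- The `n`-th Hermite function at scale `s` is localized in a region of size `O(1 / s)`. -/
theorem exists_localization (n : ℕ) : ∃ D : ℝ, 0 ≤ D ∧ ∀ (s a : ℝ) (hs : 0 < s) (W : ℝ → ℝ)
    (K : ℝ) (M : L2 →L[ℂ] L2), (∀ x, |W x - W a| ≤ K * |x - a|) →
      (∀ u : L2, M u =ᵐ[volume] fun x => (W x : ℂ) * u x) →
      ‖M (hermiteVec hs.ne' a n) - (W a : ℂ) • hermiteVec hs.ne' a n‖ ≤
        K * D / s * ‖hermiteVec hs.ne' a n‖ := by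
  set Q : ℝ := ∫ x, polyGauss 1 0 2⁻¹ (Polynomial.X * hermitePoly n) x ^ 2
  set N : ℝ := ∫ x, polyGauss 1 0 2⁻¹ (hermitePoly n) x ^ 2
  -- `D` is the root mean square of `y = s (x - a)` in the `n`-th Hermite state; by scaling it
  -- depends on neither `s` nor `a`.
  refine ⟨√(Q / N), Real.sqrt_nonneg _, fun s a hs W K M hK hM => ?_⟩
  have hK0 : 0 ≤ K := by
    have := (abs_nonneg _).trans (hK (a + 1))
    simpa using this
  have hQ0 : 0 ≤ Q := integral_nonneg fun x => sq_nonneg _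
  have hnorm : ‖hermiteVec hs.ne' a n‖ ^ 2 = s⁻¹ * N := by
    rw [hermiteVec, norm_toLp_sq, ← integral_polyGauss_sq (a := a) hs]
    refine integral_congr_ae (Eventually.of_forall fun x => ?_)
    simp [hermiteFun]
  have hN : 0 < N := by
    have h1 : 0 < ‖hermiteVec hs.ne' a n‖ ^ 2 :=
      pow_pos (norm_pos_iff.2 (hermiteVec_ne_zero hs.ne' a n)) 2
    rw [hnorm] at h1
    exact (mul_pos_iff_of_pos_left (inv_pos.2 hs)).1 h1
  have hle : ‖M (hermiteVec hs.ne' a n) - (W a : ℂ) • hermiteVec hs.ne' a n‖ ^ 2 ≤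
      (K / s) ^ 2 * (s⁻¹ * Q) := by
    rw [norm_sq_eq_integral, ← integral_polyGauss_sq (a := a) hs, ← integral_const_mul]
    refine integral_mono_of_nonneg (Eventually.of_forall fun x => by positivity)
      ((memLp_polyGauss hs.ne' (by norm_num) _).integrable_sq.const_mul _) ?_
    filter_upwards [Lp.coeFn_sub (M (hermiteVec hs.ne' a n)) ((W a : ℂ) • hermiteVec hs.ne' a n),
      Lp.coeFn_smul (W a : ℂ) (hermiteVec hs.ne' a n), hM (hermiteVec hs.ne' a n),
      hermiteVec_coe hs.ne' a n] with x g1 g2 g3 g4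
    rw [g1, Pi.sub_apply, g2, Pi.smul_apply, g3, g4, smul_eq_mul, ← sub_mul, ← Complex.ofReal_sub,
      hermiteFun, ← Complex.ofReal_mul, Complex.norm_real, ← mul_pow]
    refine pow_le_pow_left₀ (norm_nonneg _) ?_ 2 |>.trans_eq (sq_abs _)
    rw [norm_mul, Real.norm_eq_abs, Real.norm_eq_abs]
    refine (mul_le_mul_of_nonneg_right (hK x) (abs_nonneg _)).trans_eq ?_
    simp only [polyGauss, Polynomial.eval_mul, Polynomial.eval_X, abs_mul, abs_div, abs_of_pos hs,
      abs_of_nonneg hK0]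
    field_simp
  refine le_of_sq_le_sq (hle.trans_eq ?_) (by positivity)
  rw [mul_pow, hnorm, div_pow, div_pow, mul_pow, Real.sq_sqrt (by positivity)]
  field_simp

end MagneticBand

/-! ### Nonconstancy of the bands -/

theorem mainTheorem9 (W : ℝ → ℝ) (hW : ContDiff ℝ 2 W)
    (hW0 : ∃ C : ℝ, ∀ x, |W x| ≤ C)
    (hW1 : ∃ C : ℝ, ∀ x, |deriv W x| ≤ C)
    (hW2 : ∃ C : ℝ, ∀ x, |deriv (deriv W) x| ≤ C)
    (hx : ∃ x₀ : ℝ, deriv W x₀ ≠ 0)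
    (j : ℕ) (hj : 1 ≤ j) :
    ∃ b₀ : ℝ, 0 < b₀ ∧ ∀ b : ℝ, b₀ < b →
      -- for every `k`, `E_1(k) < E_2(k) < …` are exactly the eigenvalues of `h(k)`
      (∀ k : ℝ,
        StrictMonoOn (fun i : ℕ => MagneticBand.bandFunction b W i k) (Set.Ici 1) ∧
        (fun i : ℕ => MagneticBand.bandFunction b W i k) '' Set.Ici 1 =
          MagneticBand.eigenvalues b W k) ∧
      -- the infimum and the supremum of `E_j` are finite, and they are different
      BddBelow (Set.range fun k : ℝ => MagneticBand.bandFunction b W j k) ∧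
      BddAbove (Set.range fun k : ℝ => MagneticBand.bandFunction b W j k) ∧
      (⨅ k : ℝ, MagneticBand.bandFunction b W j k) <
        ⨆ k : ℝ, MagneticBand.bandFunction b W j k := by
  obtain ⟨C', hC'⟩ := hW0
  obtain ⟨K, hK⟩ := hW1
  obtain ⟨x₀, hx₀⟩ := hx
  obtain ⟨x₁, hx₁⟩ : ∃ x₁, W x₁ ≠ W x₀ := by
    by_contra! hcon
    have : W = fun _ => W x₀ := funext hcon
    rw [this] at hx₀
    simp at hx₀
  set C := max C' 1
  have hC0 : 0 < C := lt_of_lt_of_le one_pos (le_max_right _ _)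
  have hC : ∀ x, |W x| ≤ C := fun x => (hC' x).trans (le_max_left _ _)
  have hLip : ∀ y x, |W x - W y| ≤ K * |x - y| := fun y x =>
    convex_univ.norm_image_sub_le_of_norm_deriv_le
      (fun z _ => hW.differentiable (by norm_num) z) (fun z _ => hK z) trivial trivial
  have hK0 : 0 ≤ K := (abs_nonneg _).trans (hK 0)
  obtain ⟨D, hD0, hD⟩ := MagneticBand.exists_localization (j - 1)
  set d := |W x₁ - W x₀|
  have hd : 0 < d := abs_pos.2 (sub_ne_zero.2 hx₁)
  -- The first bound secures the gaps; the second makes `4KD/√b < d`.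
  refine ⟨max (10 * C) ((4 * (K * D) / d) ^ 2), lt_max_of_lt_left (by positivity), fun b hb => ?_⟩
  have hb1 : 10 * C < b := (le_max_left _ _).trans_lt hb
  have hb2 : (4 * (K * D) / d) ^ 2 < b := (le_max_right _ _).trans_lt hb
  have hb0 : 0 < b := by linarith
  set s := √b with hsdef
  have hs : 0 < s := Real.sqrt_pos.2 hb0
  have hs2 : s ^ 2 = b := Real.sq_sqrt hb0.le
  have key := MagneticBand.exists_eigenvalue_seq hW.continuous hC0 hC hs.ne' (by rw [hs2]; linarith)
  choose e hmono hrange hnear hfirst using key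
  simp only [hs2] at hrange hnear hfirst
  have hrange' : ∀ k, MagneticBand.eigenvalues b W k = Set.range (e (k / b)) := fun k => by
    rw [← hrange, mul_div_cancel₀ _ hb0.ne']
  have hband : ∀ (k : ℝ) (i : ℕ), 1 ≤ i → MagneticBand.bandFunction b W i k = e (k / b) (i - 1) :=
    fun k i hi => MagneticBand.bandFunction_eq (hmono _) (hrange' k) i hi
  have hbelow : BddBelow (Set.range fun k : ℝ => MagneticBand.bandFunction b W j k) := by
    refine ⟨(2 * (j - 1 : ℕ) + 1) * b - 2 * C, ?_⟩
    rintro _ ⟨k, rfl⟩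
    simp only [hband k j hj]
    linarith [(abs_le.1 (hnear (k / b) (j - 1))).1]
  have habove : BddAbove (Set.range fun k : ℝ => MagneticBand.bandFunction b W j k) := by
    refine ⟨(2 * (j - 1 : ℕ) + 1) * b + 2 * C, ?_⟩
    rintro _ ⟨k, rfl⟩
    simp only [hband k j hj]
    linarith [(abs_le.1 (hnear (k / b) (j - 1))).2]
  refine ⟨fun k => ⟨?_, ?_⟩, hbelow, habove, ?_⟩
  · intro i hi i' hi' hlt
    simp only [Set.mem_Ici] at hi hi'
    simp only [hband k i hi, hband k i' hi']
    exact hmono _ (by omega)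
  · rw [hrange']
    ext x
    constructor
    · rintro ⟨i, hi, rfl⟩
      exact ⟨i - 1, (hband k i hi).symm⟩
    · rintro ⟨n, rfl⟩
      exact ⟨n + 1, Nat.le_add_left 1 n, hband k (n + 1) (Nat.le_add_left 1 n)⟩
  · obtain ⟨M, hM, -, -⟩ := MagneticBand.exists_mulOp hW.continuous hC
    have hasymp : ∀ y, |MagneticBand.bandFunction b W j (b * y) -
        (2 * (j - 1 : ℕ) + 1) * b - W y| ≤ 2 * (K * D / s) := by
      intro y
      rw [hband _ j hj, mul_div_cancel_left₀ _ hb0.ne']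
      exact hfirst y (j - 1) M (W y) _ hM (hD s y hs W K M (hLip y) hM)
    have hsmall : 4 * (K * D / s) < d := by
      have h1 : 4 * (K * D) / d < s := by
        rw [hsdef]
        exact Real.lt_sqrt_of_sq_lt hb2
      rw [div_lt_iff₀ hd] at h1
      rw [← mul_div_assoc, div_lt_iff₀ hs]
      linarith
    have hne : MagneticBand.bandFunction b W j (b * x₁) ≠
        MagneticBand.bandFunction b W j (b * x₀) := by
      intro heq
      have h1 := hasymp x₁
      have h2 := hasymp x₀
      rw [heq] at h1
      -- A common band value would be within `2KD/s` of both `W x₁` and `W x₀` after the shift,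
      -- giving `d ≤ 4KD/s`.
      have h3 := abs_sub_le (W x₁) (MagneticBand.bandFunction b W j (b * x₀) -
        (2 * (j - 1 : ℕ) + 1) * b) (W x₀)
      rw [abs_sub_comm (W x₁) (_ - _)] at h3
      change d ≤ _ at h3
      linarith
    by_contra! hcon
    have hle : ∀ k k', MagneticBand.bandFunction b W j k ≤ MagneticBand.bandFunction b W j k' :=
      fun k k' => (le_ciSup habove k).trans (hcon.trans (ciInf_le hbelow k'))
    exact hne ((hle _ _).antisymm (hle _ _))
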